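/- **Definitions.** Let $P$ be a probability measure and $\mathcal G\subset\mathcal H$ two $\sigma$-algebras on which it is defined (or sub-$\sigma$-algebras of its domain). Elements of $L^\infty(\mathcal H)=L^\infty(\Omega,\mathcal H,P)$ are identified when they agree $P$-a.s. A (convex) risk measure on $L^\infty(\mathcal H)$ conditional to $L^\infty(\mathcal G)$ is a map $\rho:L^\infty(\mathcal H)\to L^\infty(\mathcal G)$ such that, for all $X,Y\in L^\infty(\mathcal H)$: $X\le Y$ implies $\rho(X)\ge\rho(Y)$; $\rho(X+Z)=\rho(X)-Z$ for all $Z\in L^\infty(\mathcal G)$; and $\rho(\lambda X+(1-\lambda)Y)\le\lambda\rho(X)+(1-\lambda)\rho(Y)$ for all $\lambda\in[0,1]$. It is *normalized* if $\rho(0)=0$, and *continuous from above* if $\rho(X_n)\to\rho(X)$ $P$-a.s. whenever $X_n\in L^\infty(\mathcal H)$ decreases $P$-a.s. to $X\in L^\infty(\mathcal H)$. For a probability measure $Q\ll P$ its *$Q$-acceptance set* is $$\mathcal A(Q)=\{Y\in L^\infty(\mathcal H): \rho(Y)\le 0\ \ Q\text{-a.s.}\},\qquad \mathcal A=\mathcal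 A(P),$$ and its *minimal penalty* is the $(-\infty,\infty]$-valued random variable, defined up to $Q$-null sets, $$\alpha(Q)=Q\text{-}\operatorname*{ess\,sup}_{X\in L^\infty(\mathcal H)}\bigl(E_Q(-X\mid\mathcal G)-\rho(X)\bigr).$$ It is bounded from below $Q$-a.s., so its (extended real valued) conditional expectations under $Q$ are defined. Indices on $\rho$ are carried over to $\mathcal A$ and $\alpha$. **Theorem.** Let $(\Omega,\mathcal F_\infty,(\mathcal F_t)_{t\ge0},P)$ be a filtered probability space whose filtration is right continuous and such that $\mathcal F_0$ is the $\sigma$-algebra generated by the $P$-null sets of $\mathcal F_\infty$. For a stopping time $\tau$ with values in $[0,\infty]$ let $\mathcal F_\tau=\{A\in\mathcal F_\infty: A\cap\{\tau\le t\}\in\mathcal F_t\ \forall t\ge 0\}$. Let $(\rho_{\sigma,\tau})_{\sigma\le\tau}$ be a dynamic risk measure, i.e. a family, indexed by the pairs of stopping times $\sigma\le\tau$, of convex risk measures $\rho_{\sigma,\tau}$ on $L^\infty(\mathcal F_\tau)$ conditional to $L^\infty(\mathcal F_\sigma)$ (not necessarily normalized), all continuous from above. Let $\nu\le\sigma\le\tau$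 be stopping times. The following are equivalent: 1. $\rho_{\nu,\tau}(X)=\rho_{\nu,\sigma}(-\rho_{\sigma,\tau}(X))$ for all $X\in L^\infty(\mathcal F_\tau)$; 2. for every probability measure $Q\ll P$, $\mathcal A_{\nu,\tau}(Q)=\mathcal A_{\nu,\sigma}(Q)+\mathcal A_{\sigma,\tau}$; 3. for every probability measure $Q\ll P$, $\alpha_{\nu,\tau}(Q)=\alpha_{\nu,\sigma}(Q)+E_Q(\alpha_{\sigma,\tau}(Q)\mid\mathcal F_\nu)$ $Q$-a.s. **Proposition.** Let $\mathcal F_1\subset\mathcal F_2\subset\mathcal F_3$ be $\sigma$-algebras on $\Omega$, $P$ a probability measure on $(\Omega,\mathcal F_3)$, and for $(i,j)\in\{(1,2),(2,3),(1,3)\}$ let $\rho_{i,j}$ be a normalized convex risk measure on $L^\infty(\mathcal F_j)$ conditional to $L^\infty(\mathcal F_i)$, continuous from above. The following are equivalent: 1. $\rho_{1,3}(X)=\rho_{1,2}(-\rho_{2,3}(X))$ for all $X\in L^\infty(\mathcal F_3)$; 2. for every probability measure $Q\ll P$ on $\mathcal F_3$, $\mathcal A_{1,3}(Q)=\mathcal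 A_{1,2}(Q)+\mathcal A_{2,3}$; 3. for every probability measure $Q\ll P$ on $\mathcal F_3$, $\alpha_{1,3}(Q)=\alpha_{1,2}(Q)+E_Q(\alpha_{2,3}(Q)\mid\mathcal F_1)$ $Q$-a.s. -/

import Mathlib

open MeasureTheory Filter Topology
open scoped ENNReal NNReal Pointwise

noncomputable section

namespace RiskMeasure

variable {Ω : Type*}

/-! ### Essential suprema of arbitrary families -/

/-- `g` is the `Q`-essential supremum of the family `f` of extended real valued random variables:
the least measurable function, up to `Q`-null sets, that dominates every member `Q`-a.s. -/
structure IsFamilyEssSup {m0 : MeasurableSpace Ω} {ι : Type*} (Q : Measure Ω)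
    (f : ι → Ω → EReal) (g : Ω → EReal) : Prop where
  measurable : Measurable g
  le : ∀ i, f i ≤ᵐ[Q] g
  least : ∀ h : Ω → EReal, Measurable h → (∀ i, f i ≤ᵐ[Q] h) → g ≤ᵐ[Q] h

theorem strictMono_aux : StrictMono fun x : EReal => (1 + EReal.exp (-x))⁻¹ := by
  intro x y h
  have h1 : EReal.exp (-y) < EReal.exp (-x) := EReal.exp_strictMono (EReal.neg_lt_neg_iff.2 h)
  exact ENNReal.inv_lt_inv.2 (ENNReal.add_lt_add_left ENNReal.one_ne_top h1)

/-- Every family of random variables on a probability space has an essential supremum. -/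
theorem exists_isFamilyEssSup {m0 : MeasurableSpace Ω} {ι : Type*} (Q : Measure Ω)
    [IsProbabilityMeasure Q] (f : ι → Ω → EReal) (hf : ∀ i, AEMeasurable (f i) Q) :
    ∃ g, IsFamilyEssSup Q f g := by
  set φ : EReal → ℝ≥0∞ := fun x => (1 + EReal.exp (-x))⁻¹ with hφ
  have hφm : Measurable φ :=
    ((EReal.measurable_exp.comp measurable_neg).const_add 1).inv
  have hφ1 : ∀ x, φ x ≤ 1 := fun x => ENNReal.inv_le_one.2 le_self_add
  let s : Set ι → Ω → EReal := fun C ω => ⨆ i ∈ C, f i ω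
  let J : Set ι → ℝ≥0∞ := fun C => ∫⁻ ω, φ (s C ω) ∂Q
  have hs : ∀ C : Set ι, C.Countable → AEMeasurable (s C) Q :=
    fun C hC => AEMeasurable.biSup C hC fun i _ => hf i
  have hsm : ∀ C D : Set ι, C ⊆ D → ∀ ω, s C ω ≤ s D ω :=
    fun C D h ω => biSup_mono fun i hi => h hi
  have hJm : ∀ C D : Set ι, C ⊆ D → J C ≤ J D :=
    fun C D h => lintegral_mono fun ω => strictMono_aux.monotone (hsm C D h ω)
  have hJ1 : ∀ C, J C ≠ ∞ := by
    intro C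
    refine ne_top_of_le_ne_top (b := 1) ENNReal.one_ne_top ?_
    calc J C ≤ ∫⁻ _, 1 ∂Q := lintegral_mono fun ω => hφ1 _
      _ = 1 := by simp
  obtain ⟨u, -, hu, huS⟩ := exists_seq_tendsto_sSup
    (S := J '' {C | C.Countable}) (Set.Nonempty.image J ⟨∅, Set.countable_empty⟩) (OrderTop.bddAbove _)
  choose C hC hCu using huS
  have hDc : (⋃ n, C n).Countable := Set.countable_iUnion hC
  have hmax : sSup (J '' {C | C.Countable}) ≤ J (⋃ n, C n) :=
    le_of_tendsto' hu fun n => by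
      rw [← hCu n]; exact hJm _ _ (Set.subset_iUnion C n)
  set D := ⋃ n, C n
  refine ⟨(hs D hDc).mk, (hs D hDc).measurable_mk, fun i => ?_, fun h _ hh => ?_⟩
  · have hEc : (insert i D).Countable := hDc.insert i
    have hle : J (insert i D) ≤ J D := (le_sSup (Set.mem_image_of_mem J hEc)).trans hmax
    have hae : (fun ω => φ (s D ω)) =ᵐ[Q] fun ω => φ (s (insert i D) ω) :=
      ae_eq_of_ae_le_of_lintegral_le
        (Eventually.of_forall fun ω => strictMono_aux.monotone
          (hsm _ _ (Set.subset_insert i D) ω))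
        (hJ1 D) (hφm.comp_aemeasurable (hs _ hEc)) hle
    filter_upwards [hae, (hs D hDc).ae_eq_mk] with ω h1 h2
    rw [← h2, strictMono_aux.injective h1]
    exact le_biSup (fun j => f j ω) (Set.mem_insert i D)
  · have : ∀ᵐ ω ∂Q, ∀ i ∈ D, f i ω ≤ h ω := (ae_ball_iff hDc).2 fun i _ => hh i
    filter_upwards [this, (hs D hDc).ae_eq_mk] with ω h1 h2
    rw [← h2]
    exact iSup₂_le h1

open scoped Classical in
/-- The `Q`-essential supremum of a family of random variables (a version of it, which exists
by `exists_isFamilyEssSup`). -/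
def familyEssSup {m0 : MeasurableSpace Ω} {ι : Type*} (Q : Measure Ω) (f : ι → Ω → EReal) :
    Ω → EReal :=
  if h : ∃ g, IsFamilyEssSup Q f g then h.choose else ⊤

/-! ### Extended real valued conditional expectation -/

/-- `E_Q(f | m) = E_Q(f⁺ | m) - E_Q(f⁻ | m)` for an extended real valued `f` (used for
functions that are bounded from below, so that `E_Q(f⁻ | m)` is finite). -/
def condExpEReal (m : MeasurableSpace Ω) {m0 : MeasurableSpace Ω} (Q : Measure Ω)
    (f : Ω → EReal) : Ω → EReal :=
  fun ω => (condLExp m Q (fun x => (f x).toENNReal) ω : EReal)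
    - (condLExp m Q (fun x => (-f x).toENNReal) ω : EReal)

/-! ### Conditional risk measures -/

/-- `L^∞(Ω, m, P)`, as the space of classes in `L^∞(Ω, m0, P)` that have an `m`-measurable
representative. -/
abbrev LInf (m : MeasurableSpace Ω) {m0 : MeasurableSpace Ω} (P : Measure Ω) :
    Submodule ℝ (Lp ℝ ∞ P) :=
  lpMeas ℝ ℝ m ∞ P

/-- The inclusion `L^∞(Ω, m, P) ⊆ L^∞(Ω, n, P)` for `m ≤ n`. -/
def LInf.incl {m n : MeasurableSpace Ω} {m0 : MeasurableSpace Ω} {P : Measure Ω} (h : m ≤ n) :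
    LInf m P →ₗ[ℝ] LInf n P :=
  Submodule.inclusion fun _ hf => mem_lpMeas_iff_aestronglyMeasurable.2
    ((mem_lpMeas_iff_aestronglyMeasurable.1 hf).mono h)

/-- A (convex) risk measure on `L^∞(Ω, n, P)` conditional to `L^∞(Ω, m, P)`. -/
structure IsConditionalRiskMeasure {m n : MeasurableSpace Ω} {m0 : MeasurableSpace Ω}
    {P : Measure Ω} (h : m ≤ n) (ρ : LInf n P → LInf m P) : Prop where
  monotone : ∀ X Y : LInf n P, X ≤ Y → ρ Y ≤ ρ X
  translation : ∀ (Z : LInf m P) (X : LInf n P), ρ (X + LInf.incl h Z) = ρ X - Z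
  convex : ∀ (X Y : LInf n P) (c : ℝ), 0 ≤ c → c ≤ 1 →
    ρ (c • X + (1 - c) • Y) ≤ c • ρ X + (1 - c) • ρ Y

/-- Continuity from above: if `X_k` decreases to `X` a.s. in `L^∞`, then `ρ(X_k)` tends to
`ρ(X)` a.s. -/
def ContinuousFromAbove {m n : MeasurableSpace Ω} {m0 : MeasurableSpace Ω} {P : Measure Ω}
    (ρ : LInf n P → LInf m P) : Prop :=
  ∀ (X : ℕ → LInf n P) (Y : LInf n P), Antitone X →
    (∀ᵐ ω ∂P, Tendsto (fun k => (X k).1 ω) atTop (𝓝 (Y.1 ω))) →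
    ∀ᵐ ω ∂P, Tendsto (fun k => (ρ (X k)).1 ω) atTop (𝓝 ((ρ Y).1 ω))

/-- The `Q`-acceptance set `{Y ∈ L^∞(Ω, n, P) | ρ(Y) ≤ 0 Q-a.s.}`. -/
def acceptanceSet {m n : MeasurableSpace Ω} {m0 : MeasurableSpace Ω} {P : Measure Ω}
    (ρ : LInf n P → LInf m P) (Q : Measure Ω) : Set (LInf n P) :=
  {Y | ∀ᵐ ω ∂Q, (ρ Y).1 ω ≤ 0}

/-- The minimal penalty
`Q ess sup {E_Q(-X | m) - ρ(X) | X ∈ L^∞(Ω, n, P)}`, with values in the extended reals. -/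
def minimalPenalty {m n : MeasurableSpace Ω} {m0 : MeasurableSpace Ω} {P : Measure Ω}
    (ρ : LInf n P → LInf m P) (Q : Measure Ω) : Ω → EReal :=
  familyEssSup Q fun (X : LInf n P) ω =>
    (((Q[fun x => -X.1 x | m]) ω - (ρ X).1 ω : ℝ) : EReal)

theorem isFamilyEssSup_minimalPenalty {m n : MeasurableSpace Ω} {m0 : MeasurableSpace Ω}
    {P : Measure Ω} (ρ : LInf n P → LInf m P) (Q : Measure Ω) [IsProbabilityMeasure Q] :
    IsFamilyEssSup Q (fun (X : LInf n P) ω =>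
      (((Q[fun x => -X.1 x | m]) ω - (ρ X).1 ω : ℝ) : EReal)) (minimalPenalty ρ Q) := by
  have h := exists_isFamilyEssSup Q (fun (X : LInf n P) ω =>
      (((Q[fun x => -X.1 x | m]) ω - (ρ X).1 ω : ℝ) : EReal)) fun X =>
    (integrable_condExp.aestronglyMeasurable.aemeasurable.sub
      (Lp.stronglyMeasurable (ρ X).1).measurable.aemeasurable).coe_real_ereal
  unfold minimalPenalty familyEssSup
  rw [dif_pos h]
  exact h.choose_spec

/-! ### Dynamic risk measures -/

/-- `𝓕_τ = {A ∈ 𝓕_∞ | A ∩ {τ ≤ t} ∈ 𝓕_t for all t}`, where `𝓕_∞` is the σ-algebra `m0` of the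
filtered space (which may be larger than the one generated by the `𝓕_t`). -/
abbrev stoppingSigma {m0 : MeasurableSpace Ω} {𝓕 : Filtration ℝ≥0 m0} {τ : Ω → WithTop ℝ≥0}
    (hτ : IsStoppingTime 𝓕 τ) : MeasurableSpace Ω where
  MeasurableSet' A := MeasurableSet[m0] A ∧ ∀ t, MeasurableSet[𝓕 t] (A ∩ {ω | τ ω ≤ t})
  measurableSet_empty := by simp
  measurableSet_compl A hA := by
    refine ⟨hA.1.compl, fun t => ?_⟩
    have : Aᶜ ∩ {ω | τ ω ≤ t} = {ω | τ ω ≤ t} \ (A ∩ {ω | τ ω ≤ t}) := by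
      ext ω; simp only [Set.mem_inter_iff, Set.mem_compl_iff, Set.mem_sdiff]; tauto
    rw [this]
    exact (hτ t).diff (hA.2 t)
  measurableSet_iUnion A hA := by
    refine ⟨MeasurableSet.iUnion fun i => (hA i).1, fun t => ?_⟩
    rw [Set.iUnion_inter]
    exact MeasurableSet.iUnion fun i => (hA i).2 t

theorem stoppingSigma_mono {m0 : MeasurableSpace Ω} {𝓕 : Filtration ℝ≥0 m0}
    {σ τ : Ω → WithTop ℝ≥0} (hσ : IsStoppingTime 𝓕 σ) (hτ : IsStoppingTime 𝓕 τ) (h : σ ≤ τ) :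
    stoppingSigma hσ ≤ stoppingSigma hτ := by
  intro A hA
  refine ⟨hA.1, fun t => ?_⟩
  have : A ∩ {ω | τ ω ≤ t} = (A ∩ {ω | σ ω ≤ t}) ∩ {ω | τ ω ≤ t} := by
    ext ω
    simp only [Set.mem_inter_iff, Set.mem_ofPred_eq]
    exact ⟨fun ⟨a, b⟩ => ⟨⟨a, (h ω).trans b⟩, b⟩, fun ⟨⟨a, _⟩, b⟩ => ⟨a, b⟩⟩
  rw [this]
  exact (hA.2 t).inter (hτ t)

/-- A dynamic risk measure: a family `ρ_{σ,τ} : L^∞(𝓕_τ) → L^∞(𝓕_σ)`, indexed by the pairs of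
stopping times `σ ≤ τ`, of convex conditional risk measures. -/
structure DynamicRiskMeasure {m0 : MeasurableSpace Ω} (𝓕 : Filtration ℝ≥0 m0)
    (P : Measure Ω) where
  rho : ∀ {σ τ : Ω → WithTop ℝ≥0} (hσ : IsStoppingTime 𝓕 σ) (hτ : IsStoppingTime 𝓕 τ),
    σ ≤ τ → LInf (stoppingSigma hτ) P → LInf (stoppingSigma hσ) P
  isRiskMeasure : ∀ {σ τ : Ω → WithTop ℝ≥0} (hσ : IsStoppingTime 𝓕 σ)
    (hτ : IsStoppingTime 𝓕 τ) (h : σ ≤ τ),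
    IsConditionalRiskMeasure (stoppingSigma_mono hσ hτ h) (rho hσ hτ h)

/-- A dynamic risk measure is continuous from above if all its members are. -/
def DynamicRiskMeasure.IsContinuousFromAbove {m0 : MeasurableSpace Ω} {𝓕 : Filtration ℝ≥0 m0}
    {P : Measure Ω} (R : DynamicRiskMeasure 𝓕 P) : Prop :=
  ∀ {σ τ : Ω → WithTop ℝ≥0} (hσ : IsStoppingTime 𝓕 σ) (hτ : IsStoppingTime 𝓕 τ) (h : σ ≤ τ),
    ContinuousFromAbove (R.rho hσ hτ h)

/-! ### The three properties of a composition -/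

/-- `ρ_{1,3}(X) = ρ_{1,2}(-ρ_{2,3}(X))` for all `X`. -/
def Composition {m1 m2 m3 : MeasurableSpace Ω} {m0 : MeasurableSpace Ω} {P : Measure Ω}
    (ρ12 : LInf m2 P → LInf m1 P) (ρ23 : LInf m3 P → LInf m2 P)
    (ρ13 : LInf m3 P → LInf m1 P) : Prop :=
  ∀ X : LInf m3 P, ρ13 X = ρ12 (-ρ23 X)

/-- `A_{1,3}(Q) = A_{1,2}(Q) + A_{2,3}` for all probability measures `Q ≪ P`, where
`A_{2,3} = A_{2,3}(P)`. -/
def AcceptanceDecomposition {m1 m2 m3 : MeasurableSpace Ω} {m0 : MeasurableSpace Ω}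
    {P : Measure Ω} (h23 : m2 ≤ m3) (ρ12 : LInf m2 P → LInf m1 P)
    (ρ23 : LInf m3 P → LInf m2 P) (ρ13 : LInf m3 P → LInf m1 P) : Prop :=
  ∀ Q : Measure Ω, IsProbabilityMeasure Q → Q ≪ P →
    acceptanceSet ρ13 Q = LInf.incl h23 '' acceptanceSet ρ12 Q + acceptanceSet ρ23 P

/-- The cocycle condition `α_{1,3}(Q) = α_{1,2}(Q) + E_Q(α_{2,3}(Q) | m1)` `Q`-a.s., for all
probability measures `Q ≪ P`. -/
def CocycleCondition {m1 m2 m3 : MeasurableSpace Ω} {m0 : MeasurableSpace Ω} {P : Measure Ω}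
    (ρ12 : LInf m2 P → LInf m1 P) (ρ23 : LInf m3 P → LInf m2 P)
    (ρ13 : LInf m3 P → LInf m1 P) : Prop :=
  ∀ Q : Measure Ω, IsProbabilityMeasure Q → Q ≪ P →
    minimalPenalty ρ13 Q =ᵐ[Q]
      fun ω => minimalPenalty ρ12 Q ω + condExpEReal m1 Q (minimalPenalty ρ23 Q) ω

end RiskMeasure

end

/-!
Both parts of the theorem are instances of one equivalence, for three nested `σ`-algebras
`m1 ≤ m2 ≤ m3` and conditional risk measures that are continuous from above (`tfae_composition`).

*Composition and acceptance sets.* Writing `X = -ρ23 X + (X + ρ23 X)`, where the second term has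
zero risk, monotonicity and translation invariance give both directions; the converse uses
acceptance sets for `Q = P` only (`composition_iff_acceptanceDecomposition`).

*Composition implies the cocycle condition.* Put `f(X) = E_Q(-X | m) - ρ(X)` (`excess`). By the
tower property `f13(X) = E_Q(f23(X) | m1) + f12(-ρ23 X)`, and since `f23` is invariant under
translations of `X` by `m2`-measurable variables, the two summands can be prescribed independently.
Risk measures are local, so the family `f` is directed upwards and its essential supremum is an
increasing limit (`exists_seq_minimalPenalty`), which commutes with conditional expectation
(`condExpEReal_iSup`). See `cocycleCondition_of_composition`.

*The cocycle condition implies composition.* The map `X ↦ ρ12 (-ρ23 X)` is itself a conditional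
risk measure that is continuous from above, and by the previous step its penalties are those of
`ρ13`. A risk measure that is continuous from above is determined by its penalties
(`le_of_minimalPenalty_le`): for every probability measure `S ≪ P`, the functional `E_S ρ` has at
each `X` an `ε`-subgradient given by a probability measure `Q ≪ P` that agrees with `S` on `m`
(`exists_measure_minorant`).

The existence of a countably additive subgradient is a Krein–Šmulian type statement:
`E_S ρ` is lower semicontinuous on balls of `L^∞` for the `L^2` topology (`lscOnBalls_integral`),
and this suffices to approximate it from below by `L^2` densities that converge in `L^1`
(`exists_seq_inner_minorant`). The densities are built by successive corrections: as long as the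
remaining function is bounded below by `-ε - δ‖·‖`, a Hahn–Banach separation in `L^2 × ℝ` gives a
density of `L^1` norm about `δ` whose subtraction improves the slope from `δ` to `δ / 2`.
-/

namespace RiskMeasure

/-! ### Linear minorants that are limits of weaker-topology continuous functionals -/

/-- A decreasing sequence of nonempty bounded closed convex sets in a Hilbert space has a common
point: the elements of minimal norm form a Cauchy sequence by the parallelogram law. -/
theorem exists_mem_iInter_of_antitone_convex {H : Type*} [NormedAddCommGroup H]
    [InnerProductSpace ℝ H] [CompleteSpace H] (C : ℕ → Set H) (hC : Antitone C)
    (hne : ∀ n, (C n).Nonempty) (hcl : ∀ n, IsClosed (C n)) (hcv : ∀ n, Convex ℝ (C n))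
    (r : ℝ) (hr : ∀ n, ∀ x ∈ C n, ‖x‖ ≤ r) : ∃ x, ∀ n, x ∈ C n := by
  have hmin : ∀ n, ∃ v ∈ C n, ∀ w ∈ C n, ‖v‖ ≤ ‖w‖ := by
    intro n
    obtain ⟨v, hv, hvn⟩ := exists_norm_eq_iInf_of_complete_convex (hne n) (hcl n).isComplete
      (hcv n) 0
    refine ⟨v, hv, fun w hw => ?_⟩
    rw [zero_sub, norm_neg] at hvn
    rw [hvn]
    have hb : BddBelow (Set.range fun w : C n => ‖(0 : H) - w‖) :=
      ⟨0, by rintro _ ⟨w, rfl⟩; exact norm_nonneg _⟩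
    simpa using ciInf_le hb ⟨w, hw⟩
  choose v hv hvmin using hmin
  have hmono : Monotone fun n => ‖v n‖ ^ 2 := fun n m h =>
    pow_le_pow_left₀ (norm_nonneg _) (hvmin n _ (hC h (hv m))) 2
  have hbdd : BddAbove (Set.range fun n => ‖v n‖ ^ 2) :=
    ⟨r ^ 2, by rintro _ ⟨n, rfl⟩; exact pow_le_pow_left₀ (norm_nonneg _) (hr n _ (hv n)) 2⟩
  have hcau := (tendsto_atTop_ciSup hmono hbdd).cauchySeq
  have key : ∀ n m, n ≤ m → ‖v n - v m‖ ^ 2 ≤ 2 * (‖v m‖ ^ 2 - ‖v n‖ ^ 2) := by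
    intro n m h
    have hp := parallelogram_law_with_norm ℝ (v n) (v m)
    have hmid : (1 / 2 : ℝ) • v n + (1 / 2 : ℝ) • v m ∈ C n :=
      hcv n (hv n) (hC h (hv m)) (by norm_num) (by norm_num) (by norm_num)
    have h1 := hvmin n _ hmid
    rw [← smul_add, norm_smul] at h1
    norm_num at h1
    have h2 : (2 * ‖v n‖) ^ 2 ≤ ‖v n + v m‖ ^ 2 :=
      pow_le_pow_left₀ (by positivity) (by linarith) 2
    nlinarith
  have hvc : CauchySeq v := by
    rw [Metric.cauchySeq_iff'] at hcau ⊢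
    intro ε hε
    obtain ⟨N, hN⟩ := hcau (ε ^ 2 / 2) (by positivity)
    refine ⟨N, fun n hn => ?_⟩
    have h1 := key N n hn
    have h2 := hN n hn
    rw [Real.dist_eq] at h2
    have h3 := (abs_lt.1 h2).2
    rw [dist_comm, dist_eq_norm]
    refine lt_of_pow_lt_pow_left₀ 2 hε.le ?_
    linarith
  obtain ⟨x, hx⟩ := cauchySeq_tendsto_of_complete hvc
  refine ⟨x, fun n => (hcl n).mem_of_tendsto hx ?_⟩
  filter_upwards [eventually_ge_atTop n] with m hm using hC hm (hv m)

theorem norm_add_smul_le {E : Type*} [NormedAddCommGroup E] [NormedSpace ℝ E] {x y : E}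
    {a b c : ℝ} (hx : ‖x‖ ≤ c) (hy : ‖y‖ ≤ c) (ha : 0 ≤ a) (hb : 0 ≤ b) (hab : a + b = 1) :
    ‖a • x + b • y‖ ≤ c :=
  mem_closedBall_zero_iff.1 ((convex_closedBall (0 : E) c) (mem_closedBall_zero_iff.2 hx)
    (mem_closedBall_zero_iff.2 hy) ha hb hab)

section Minorant

variable {V H : Type*} [NormedAddCommGroup V] [NormedSpace ℝ V] [NormedAddCommGroup H]
  [InnerProductSpace ℝ H]

/-- `ψ` is sequentially lower semicontinuous on the balls of `V` for the topology induced by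
`J : V → H`, and these balls are sequentially closed in `H`. -/
def LscOnBalls (J : V →L[ℝ] H) (ψ : V → ℝ) : Prop :=
  ∀ (r : ℝ) (v : ℕ → V) (y : H), (∀ k, ‖v k‖ ≤ r) → Tendsto (fun k => J (v k)) atTop (𝓝 y) →
    ∃ u, ‖u‖ ≤ r ∧ J u = y ∧ ∀ c, (∀ᶠ k in atTop, ψ (v k) ≤ c) → ψ u ≤ c

theorem LscOnBalls.sub_inner {J : V →L[ℝ] H} {ψ : V → ℝ} (h : LscOnBalls J ψ) (g : H) :
    LscOnBalls J fun v => ψ v - inner ℝ g (J v) := by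
  intro r v y hv hy
  obtain ⟨u, hu, hJu, hc⟩ := h r v y hv hy
  refine ⟨u, hu, hJu, fun c hvc => ?_⟩
  have hlim : Tendsto (fun k => inner ℝ g (J (v k))) atTop (𝓝 (inner ℝ g y)) :=
    ((innerSL ℝ g).continuous.tendsto y).comp hy
  refine le_of_forall_pos_le_add fun η hη => ?_
  have := hc (c + inner ℝ g y + η) (by
    filter_upwards [hvc, hlim.eventually (gt_mem_nhds (lt_add_of_pos_right _ hη))] with k h1 h2
    linarith)
  simp only [hJu]
  linarith

theorem convexOn_sub_inner {J : V →L[ℝ] H} {ψ : V → ℝ} (h : ConvexOn ℝ Set.univ ψ) (g : H) :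
    ConvexOn ℝ Set.univ fun v => ψ v - inner ℝ g (J v) := by
  refine h.sub ⟨convex_univ, fun x _ y _ a b _ _ _ => ?_⟩
  simp [inner_add_right, inner_smul_right]

variable [CompleteSpace H]

/-- If `ψ ≥ -ε - δ‖·‖`, then the epigraph of the inf-convolution of `ψ` with `δ‖·‖` (restricted
to a ball), viewed in `H × ℝ`, stays away from the points `(0, -ε')` with `ε' > ε`. -/
theorem notMem_closure_epigraph {J : V →L[ℝ] H} (hJ : Function.Injective J) {ψ : V → ℝ}
    (hψ : ConvexOn ℝ Set.univ ψ) (hlsc : LscOnBalls J ψ) {ε ε' δ R : ℝ} (hε : ε < ε')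
    (hδ : 0 ≤ δ) (hlow : ∀ v, -ε - δ * ‖v‖ ≤ ψ v) :
    ((0 : H), -ε') ∉ closure {p : H × ℝ | ∃ v w : V, ‖v‖ ≤ R ∧ ‖w‖ ≤ R ∧ p.1 = J v + J w ∧
      ψ v + δ * ‖w‖ ≤ p.2} := by
  intro hmem
  have hex : ∀ k : ℕ, ∃ v w : V, ‖v‖ ≤ R ∧ ‖w‖ ≤ R ∧ ‖J v + J w‖ ≤ 1 / ((k : ℝ) + 1) ∧
      ψ v + δ * ‖w‖ ≤ -ε' + 1 / ((k : ℝ) + 1) := by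
    intro k
    obtain ⟨p, ⟨v, w, hv, hw, hp1, hp2⟩, hd⟩ :=
      Metric.mem_closure_iff.1 hmem (1 / ((k : ℝ) + 1)) (by positivity)
    rw [Prod.dist_eq, max_lt_iff] at hd
    obtain ⟨hd1, hd2⟩ := hd
    refine ⟨v, w, hv, hw, ?_, ?_⟩
    · rw [dist_zero_left, hp1] at hd1
      exact hd1.le
    · rw [dist_comm, Real.dist_eq] at hd2
      have := (abs_lt.1 hd2).2
      simp only at this
      linarith
  choose v w hv hw hvw hψvw using hex
  obtain ⟨s, -, φ, hφ, hs⟩ := (isCompact_Icc (a := (0 : ℝ)) (b := R)).tendsto_subseq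
    (x := fun k => ‖w k‖) fun k => ⟨norm_nonneg _, hw k⟩
  let η : ℕ → ℝ := fun n => 1 / ((n : ℝ) + 1)
  have hη0 : ∀ n, 0 < η n := fun n => by positivity
  have hηanti : Antitone η := fun n m h => one_div_le_one_div_of_le (by positivity)
    (by have : (n : ℝ) ≤ m := by exact_mod_cast h
        linarith)
  have hηlim : Tendsto η atTop (𝓝 0) := tendsto_one_div_add_atTop_nhds_zero_nat
  let K : ℕ → Set (V × V) := fun n => {p | ‖p.1‖ ≤ R ∧ ψ p.1 ≤ -ε' - δ * s + η n ∧
    ‖p.2‖ ≤ s + η n ∧ ‖J p.1 + J p.2‖ ≤ η n}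
  have hKanti : Antitone K := fun n m h p ⟨h1, h2, h3, h4⟩ =>
    ⟨h1, h2.trans (by linarith [hηanti h]), h3.trans (by linarith [hηanti h]),
      h4.trans (hηanti h)⟩
  have hKne : ∀ n, (K n).Nonempty := by
    intro n
    have hs' : Tendsto (fun k => δ * ‖w (φ k)‖) atTop (𝓝 (δ * s)) := hs.const_mul δ
    have h1 := hs.eventually (gt_mem_nhds (lt_add_of_pos_right s (hη0 n)))
    have h2 := hs'.eventually (lt_mem_nhds (sub_lt_self (δ * s) (half_pos (hη0 n))))
    have h3 := (hηlim.comp hφ.tendsto_atTop).eventually (gt_mem_nhds (half_pos (hη0 n)))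
    obtain ⟨k, h1, h2, h3⟩ := (h1.and (h2.and h3)).exists
    simp only [Function.comp] at h1 h3
    refine ⟨(v (φ k), w (φ k)), hv _, ?_, h1.le, (hvw (φ k)).trans ?_⟩
    · have := hψvw (φ k)
      change _ ≤ -ε' + η (φ k) at this
      simp only
      linarith
    · change η (φ k) ≤ η n
      linarith [hη0 n]
  have hKcv : ∀ n, Convex ℝ (K n) := by
    intro n p ⟨h1, h2, h3, h4⟩ q ⟨g1, g2, g3, g4⟩ a b ha hb hab
    refine ⟨norm_add_smul_le h1 g1 ha hb hab, ?_, norm_add_smul_le h3 g3 ha hb hab, ?_⟩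
    · have := hψ.2 (Set.mem_univ p.1) (Set.mem_univ q.1) ha hb hab
      refine this.trans ?_
      simp only [smul_eq_mul]
      calc _ ≤ a * (-ε' - δ * s + η n) + b * (-ε' - δ * s + η n) := by gcongr
        _ = _ := by rw [← add_mul, hab, one_mul]
    · have : J (a • p + b • q).1 + J (a • p + b • q).2 =
          a • (J p.1 + J p.2) + b • (J q.1 + J q.2) := by
        simp only [Prod.fst_add, Prod.snd_add, Prod.smul_fst, Prod.smul_snd, map_add, map_smul,
          smul_add]
        abel
      rw [this]
      exact norm_add_smul_le h4 g4 ha hb hab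
  obtain ⟨y, hy⟩ := exists_mem_iInter_of_antitone_convex
    (fun n => closure ((fun p : V × V => J p.1) '' K n))
    (fun n m h => closure_mono (Set.image_mono (hKanti h)))
    (fun n => ((hKne n).image _).closure) (fun n => isClosed_closure)
    (fun n => ((hKcv n).linear_image (J.toLinearMap ∘ₗ LinearMap.fst ℝ V V)).closure)
    (‖J‖ * R) (by
      intro n x hx
      have hsub : (fun p : V × V => J p.1) '' K n ⊆ Metric.closedBall 0 (‖J‖ * R) := by
        rintro _ ⟨p, hp, rfl⟩
        rw [mem_closedBall_zero_iff]
        exact (J.le_opNorm _).trans (by gcongr; exact hp.1)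
      exact mem_closedBall_zero_iff.1 (closure_minimal hsub Metric.isClosed_closedBall hx))
  have hch : ∀ n, ∃ p ∈ K n, ‖J p.1 - y‖ < η n := by
    intro n
    obtain ⟨_, ⟨p, hp, rfl⟩, hd⟩ := Metric.mem_closure_iff.1 (hy n) (η n) (hη0 n)
    exact ⟨p, hp, by rwa [← dist_eq_norm, dist_comm]⟩
  choose p hpK hpy using hch
  have hlim1 : Tendsto (fun n => J (p n).1) atTop (𝓝 y) := by
    rw [tendsto_iff_norm_sub_tendsto_zero]
    exact squeeze_zero (fun _ => norm_nonneg _) (fun n => (hpy n).le) hηlim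
  have hlim2 : Tendsto (fun n => J (-(p n).2)) atTop (𝓝 y) := by
    have h0 : Tendsto (fun n => J (p n).1 + J (p n).2) atTop (𝓝 0) :=
      squeeze_zero_norm (fun n => (hpK n).2.2.2) hηlim
    have := hlim1.sub h0
    simpa using this
  obtain ⟨u, hu, hJu, hψu⟩ := hlsc R (fun n => (p n).1) y (fun n => (hpK n).1) hlim1
  have hψu' : ψ u ≤ -ε' - δ * s := by
    refine le_of_forall_pos_le_add fun t ht => hψu _ ?_
    filter_upwards [hηlim.eventually (gt_mem_nhds ht)] with n hn
    linarith [(hpK n).2.1]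
  have hus : ‖u‖ ≤ s := by
    refine le_of_forall_pos_le_add fun t ht => ?_
    obtain ⟨N, hN⟩ := (hηlim.eventually (gt_mem_nhds ht)).exists
    obtain ⟨z, hz, hJz, -⟩ := hlsc (s + η N) (fun n => -(p (n + N)).2) y
      (fun n => by
        rw [norm_neg]
        exact (hpK (n + N)).2.2.1.trans (by linarith [hηanti (Nat.le_add_left N n)]))
      ((tendsto_add_atTop_iff_nat N).2 hlim2)
    rw [hJ (hJu.trans hJz.symm)]
    linarith
  have := hlow u
  nlinarith [mul_le_mul_of_nonneg_left hus hδ]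

/-- One correction step: a lower bound with slope `δ` is improved to slope `δ'` by subtracting a
functional that is continuous for the topology of `H` and has norm at most `δ + δ'` on `V`. -/
theorem exists_inner_minorant_step {J : V →L[ℝ] H} (hJ : Function.Injective J) {ψ : V → ℝ}
    (hψ : ConvexOn ℝ Set.univ ψ) (h0 : ψ 0 = 0) (hlsc : LscOnBalls J ψ) {ε ε' δ δ' : ℝ}
    (hε0 : 0 ≤ ε) (hε : ε < ε') (hδ : 0 ≤ δ) (hδ' : 0 < δ') (hlow : ∀ v, -ε - δ * ‖v‖ ≤ ψ v) :
    ∃ g : H, (∀ v, |inner ℝ g (J v)| ≤ (δ + δ') * ‖v‖) ∧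
      ∀ v, -ε' - δ' * ‖v‖ ≤ ψ v - inner ℝ g (J v) := by
  have hε' : 0 < ε' := hε0.trans_lt hε
  set R : ℝ := ε' / δ' with hR
  have hR0 : 0 < R := by positivity
  set E : Set (H × ℝ) := {p : H × ℝ | ∃ v w : V, ‖v‖ ≤ R ∧ ‖w‖ ≤ R ∧ p.1 = J v + J w ∧
      ψ v + δ * ‖w‖ ≤ p.2} with hE
  have hEcv : Convex ℝ E := by
    rintro p ⟨v, w, hv, hw, hp1, hp2⟩ q ⟨v', w', hv', hw', hq1, hq2⟩ a b ha hb hab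
    refine ⟨a • v + b • v', a • w + b • w', norm_add_smul_le hv hv' ha hb hab, norm_add_smul_le hw hw' ha hb hab, ?_, ?_⟩
    · simp only [Prod.fst_add, Prod.smul_fst, hp1, hq1, map_add, map_smul, smul_add]
      abel
    · have h1 := hψ.2 (Set.mem_univ v) (Set.mem_univ v') ha hb hab
      have h2 : ‖a • w + b • w'‖ ≤ a * ‖w‖ + b * ‖w'‖ := by
        refine (norm_add_le _ _).trans ?_
        rw [norm_smul, norm_smul, Real.norm_of_nonneg ha, Real.norm_of_nonneg hb]
      simp only [smul_eq_mul] at h1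
      simp only [Prod.snd_add, Prod.smul_snd, smul_eq_mul]
      nlinarith [mul_le_mul_of_nonneg_left h2 hδ, mul_le_mul_of_nonneg_left hp2 ha,
        mul_le_mul_of_nonneg_left hq2 hb]
  obtain ⟨f, u, hfu, hf⟩ := geometric_hahn_banach_point_closed hEcv.closure isClosed_closure
    (notMem_closure_epigraph hJ hψ hlsc (R := R) hε hδ hlow)
  set b : ℝ := f (0, 1) with hb
  have hfsplit : ∀ x t, f (x, t) = f (x, 0) + t * b := by
    intro x t
    have : ((x, t) : H × ℝ) = (x, 0) + t • (0, 1) := by simp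
    rw [this, map_add, map_smul, smul_eq_mul]
  have hmain : ∀ v w : V, ‖v‖ ≤ R → ‖w‖ ≤ R →
      -ε' * b < f (J v + J w, 0) + (ψ v + δ * ‖w‖) * b := by
    intro v w hv hw
    have h1 := hf (J v + J w, ψ v + δ * ‖w‖) (subset_closure ⟨v, w, hv, hw, rfl, le_rfl⟩)
    rw [hfsplit] at h1 hfu
    have h3 : f ((0 : H), (0 : ℝ)) = 0 := map_zero f
    linarith
  have hb0 : 0 < b := by
    have := hmain 0 0 (by simpa using hR0.le) (by simpa using hR0.le)
    have h3 : f ((0 : H), (0 : ℝ)) = 0 := map_zero f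
    simp only [map_zero, add_zero, h3, h0, norm_zero, mul_zero, zero_mul] at this
    nlinarith
  obtain ⟨a, ha⟩ : ∃ a : H, ∀ x, f (x, 0) = inner ℝ a x := by
    refine ⟨(InnerProductSpace.toDual ℝ H).symm (f.comp (ContinuousLinearMap.inl ℝ H ℝ)),
      fun x => ?_⟩
    rw [InnerProductSpace.toDual_symm_apply]
    rfl
  set g : H := -(b⁻¹ • a) with hg
  have hga : ∀ x, inner ℝ a x = -b * inner ℝ g x := by
    intro x
    rw [hg, inner_neg_left, inner_smul_left]
    simp only [conj_trivial]
    field_simp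
  have hmain' : ∀ v w : V, ‖v‖ ≤ R → ‖w‖ ≤ R →
      -ε' ≤ ψ v + δ * ‖w‖ - inner ℝ g (J v) - inner ℝ g (J w) := by
    intro v w hv hw
    have h1 := hmain v w hv hw
    rw [ha, hga, inner_add_right] at h1
    have h2 : b * (-ε') < b * (ψ v + δ * ‖w‖ - inner ℝ g (J v) - inner ℝ g (J w)) := by
      nlinarith
    exact (lt_of_mul_lt_mul_left h2 hb0.le).le
  have hεR : ε' = δ' * R := by rw [hR]; field_simp
  have hscale : ∀ v : V, v ≠ 0 → ‖(R / ‖v‖) • v‖ = R := fun v hv => by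
    rw [norm_smul, Real.norm_of_nonneg (by positivity)]
    field_simp [norm_ne_zero_iff.2 hv]
  have hupper : ∀ v, inner ℝ g (J v) ≤ (δ + δ') * ‖v‖ := by
    intro v
    rcases eq_or_ne v 0 with rfl | hv
    · simp
    have hv0 : 0 < ‖v‖ := norm_pos_iff.2 hv
    have h1 := hmain' 0 ((R / ‖v‖) • v) (by simpa using hR0.le) (hscale v hv).le
    rw [hscale v hv, h0, map_zero, inner_zero_right, map_smul, inner_smul_right] at h1
    have h2 : R / ‖v‖ * inner ℝ g (J v) ≤ R / ‖v‖ * ((δ + δ') * ‖v‖) := by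
      have : R / ‖v‖ * ((δ + δ') * ‖v‖) = (δ + δ') * R := by field_simp
      rw [this]
      linarith
    exact le_of_mul_le_mul_left h2 (by positivity)
  refine ⟨g, fun v => abs_le.2 ⟨?_, hupper v⟩, fun v => ?_⟩
  · have := hupper (-v)
    rw [map_neg, inner_neg_right, norm_neg] at this
    linarith
  · rcases le_or_gt ‖v‖ R with hv | hv
    · have := hmain' v 0 hv (by simpa using hR0.le)
      simp only [norm_zero, mul_zero, map_zero, inner_zero_right] at this
      nlinarith [norm_nonneg v]
    · -- outside the ball, use convexity along the segment from `0` to `v`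
      have hv0 : 0 < ‖v‖ := hR0.trans hv
      have hl0 : 0 < R / ‖v‖ := by positivity
      have hl1 : R / ‖v‖ ≤ 1 := (div_le_one hv0).2 hv.le
      have h1 := hmain' ((R / ‖v‖) • v) 0 (hscale v (norm_pos_iff.1 hv0)).le
        (by simpa using hR0.le)
      have h2 := hψ.2 (Set.mem_univ v) (Set.mem_univ 0) hl0.le (sub_nonneg.2 hl1) (by ring)
      simp only [smul_zero, add_zero, h0, smul_eq_mul, mul_zero] at h2
      simp only [norm_zero, mul_zero, map_zero, inner_zero_right, map_smul,
        inner_smul_right] at h1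
      have h3 : R / ‖v‖ * (-(δ' * ‖v‖)) ≤ R / ‖v‖ * (ψ v - inner ℝ g (J v)) := by
        have : R / ‖v‖ * (-(δ' * ‖v‖)) = -ε' := by rw [hεR]; field_simp
        rw [this]
        linarith
      have := le_of_mul_le_mul_left h3 hl0
      linarith

/-- A convex function `ψ ≥ -‖·‖` on `V` that is lower semicontinuous on balls for the topology
of `H` is minorized, up to `ε` and a vanishing slope, by functionals continuous for the
topology of `H` that converge geometrically for the dual norm of `V`. -/
theorem exists_seq_inner_minorant {J : V →L[ℝ] H} (hJ : Function.Injective J) {ψ : V → ℝ}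
    (hψ : ConvexOn ℝ Set.univ ψ) (h0 : ψ 0 = 0) (hlsc : LscOnBalls J ψ)
    (hlow : ∀ v, -‖v‖ ≤ ψ v) {ε : ℝ} (hε : 0 < ε) :
    ∃ g : ℕ → H, (∀ k v, |inner ℝ (g (k + 1) - g k) (J v)| ≤ 2 * (1 / 2) ^ k * ‖v‖) ∧
      ∀ k v, -ε - (1 / 2) ^ k * ‖v‖ ≤ ψ v - inner ℝ (g k) (J v) := by
  let I : ℕ → H → Prop := fun k g =>
    ∀ v, -(ε * (1 - (1 / 2) ^ k)) - (1 / 2) ^ k * ‖v‖ ≤ ψ v - inner ℝ g (J v)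
  have hpow : ∀ k : ℕ, (0 : ℝ) < (1 / 2) ^ k := fun k => by positivity
  have hpow1 : ∀ k : ℕ, ((1 : ℝ) / 2) ^ k ≤ 1 := fun k => pow_le_one₀ (by norm_num) (by norm_num)
  have step : ∀ (k : ℕ) (g : {g // I k g}), ∃ g' : {g // I (k + 1) g},
      ∀ v, |inner ℝ (g'.1 - g.1) (J v)| ≤ 2 * (1 / 2) ^ k * ‖v‖ := by
    intro k g
    obtain ⟨d, hd1, hd2⟩ := exists_inner_minorant_step hJ (convexOn_sub_inner (J := J) hψ g.1)
      (by simp [h0]) (hlsc.sub_inner g.1) (ε := ε * (1 - (1 / 2) ^ k))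
      (ε' := ε * (1 - (1 / 2) ^ (k + 1))) (δ := (1 / 2) ^ k) (δ' := (1 / 2) ^ (k + 1))
      (mul_nonneg hε.le (by linarith [hpow1 k]))
      (mul_lt_mul_of_pos_left (by rw [pow_succ]; linarith [hpow k]) hε)
      (hpow k).le (hpow (k + 1)) g.2
    refine ⟨⟨g.1 + d, fun v => ?_⟩, fun v => ?_⟩
    · have := hd2 v
      rw [inner_add_left]
      linarith
    · simp only [add_sub_cancel_left]
      refine (hd1 v).trans ?_
      gcongr
      rw [pow_succ]
      linarith [hpow k]
  choose next hnext using step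
  let g : (k : ℕ) → {g // I k g} := fun k =>
    Nat.rec ⟨0, fun v => by simpa using hlow v⟩ (fun k gk => next k gk) k
  refine ⟨fun k => (g k).1, fun k v => hnext k (g k) v, fun k v => ?_⟩
  have := (g k).2 v
  nlinarith [mul_pos hε (hpow k)]

end Minorant

/-! ### Bounded random variables and elementary properties of risk measures -/

section Basic

variable {Ω : Type*} {m n m0 : MeasurableSpace Ω} {P : Measure Ω}

theorem LInf.coeFn_add (X Y : LInf n P) : ∀ᵐ ω ∂P, (X + Y).1 ω = X.1 ω + Y.1 ω :=
  Lp.coeFn_add X.1 Y.1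

theorem LInf.coeFn_sub (X Y : LInf n P) : ∀ᵐ ω ∂P, (X - Y).1 ω = X.1 ω - Y.1 ω :=
  Lp.coeFn_sub X.1 Y.1

theorem LInf.coeFn_neg (X : LInf n P) : ∀ᵐ ω ∂P, (-X).1 ω = -X.1 ω :=
  Lp.coeFn_neg X.1

theorem LInf.coeFn_smul (c : ℝ) (X : LInf n P) : ∀ᵐ ω ∂P, (c • X).1 ω = c * X.1 ω :=
  Lp.coeFn_smul c X.1

theorem LInf.coeFn_zero : ∀ᵐ ω ∂P, (0 : LInf n P).1 ω = 0 :=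
  Lp.coeFn_zero ℝ ∞ P

theorem LInf.le_iff (X Y : LInf n P) : X ≤ Y ↔ ∀ᵐ ω ∂P, X.1 ω ≤ Y.1 ω :=
  (Lp.coeFn_le X.1 Y.1).symm

theorem LInf.ext_ae {X Y : LInf n P} (h : ∀ᵐ ω ∂P, X.1 ω = Y.1 ω) : X = Y :=
  Subtype.ext (Lp.ext h)

theorem LInf.aestronglyMeasurable (X : LInf n P) : AEStronglyMeasurable[n] X.1 P :=
  mem_lpMeas_iff_aestronglyMeasurable.1 X.2

theorem LInf.ae_abs_le (X : LInf n P) : ∀ᵐ ω ∂P, |X.1 ω| ≤ ‖X‖ := by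
  have h : ‖X‖ = (eLpNormEssSup X.1 P).toReal := by
    rw [← eLpNorm_exponent_top]
    rfl
  filter_upwards [ae_le_eLpNormEssSup (f := X.1) (μ := P)] with ω hω
  rw [h, ← Real.norm_eq_abs, ← toReal_enorm]
  refine ENNReal.toReal_mono ?_ hω
  rw [← eLpNorm_exponent_top]
  exact Lp.eLpNorm_ne_top X.1

theorem LInf.norm_le {X : LInf n P} {c : ℝ} (hc : 0 ≤ c) (h : ∀ᵐ ω ∂P, |X.1 ω| ≤ c) :
    ‖X‖ ≤ c := by
  have h1 : eLpNorm X.1 ∞ P ≤ ENNReal.ofReal c := by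
    rw [eLpNorm_exponent_top]
    refine eLpNormEssSup_le_of_ae_bound ?_
    simpa [Real.norm_eq_abs] using h
  exact ENNReal.toReal_le_of_le_ofReal hc h1

/-- A bounded `n`-measurable function defines an element of `L^∞(n)`. -/
theorem LInf.exists_coeFn_eq (hn : n ≤ m0) {f : Ω → ℝ} (hf : AEStronglyMeasurable[n] f P) {c : ℝ}
    (hc : ∀ᵐ ω ∂P, |f ω| ≤ c) : ∃ X : LInf n P, ∀ᵐ ω ∂P, X.1 ω = f ω := by
  have hmem : MemLp f ∞ P := memLp_top_of_bound (hf.mono hn) c (by simpa using hc)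
  refine ⟨⟨hmem.toLp f, mem_lpMeas_iff_aestronglyMeasurable.2 ?_⟩, hmem.coeFn_toLp⟩
  exact hf.congr hmem.coeFn_toLp.symm

theorem LInf.aestronglyMeasurable' {Q : Measure Ω} (hQ : Q ≪ P) (X : LInf n P) :
    AEStronglyMeasurable[n] X.1 Q :=
  ⟨(LInf.aestronglyMeasurable X).mk, (LInf.aestronglyMeasurable X).stronglyMeasurable_mk,
    hQ.ae_le (LInf.aestronglyMeasurable X).ae_eq_mk⟩

theorem LInf.integrable (hn : n ≤ m0) {Q : Measure Ω} [IsFiniteMeasure Q] (hQ : Q ≪ P)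
    (X : LInf n P) : Integrable X.1 Q := by
  have hb : ∀ᵐ ω ∂Q, |X.1 ω| ≤ ‖X‖ := hQ.ae_le (LInf.ae_abs_le X)
  exact Integrable.of_bound ((LInf.aestronglyMeasurable' hQ X).mono hn) ‖X‖ (by simpa using hb)

theorem LInf.exists_const (hn : n ≤ m0) (P : Measure Ω) (c : ℝ) :
    ∃ X : LInf n P, ∀ᵐ ω ∂P, X.1 ω = c :=
  LInf.exists_coeFn_eq hn (f := fun _ => c) aestronglyMeasurable_const (c := |c|) (by simp)

theorem LInf.exists_indicator (hn : n ≤ m0) (P : Measure Ω) {A : Set Ω} (hA : MeasurableSet[n] A)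
    (c : ℝ) : ∃ X : LInf n P, ∀ᵐ ω ∂P, X.1 ω = A.indicator (fun _ => c) ω :=
  LInf.exists_coeFn_eq hn (f := A.indicator fun _ => c)
    ((stronglyMeasurable_const.indicator hA).aestronglyMeasurable) (c := |c|)
    (Eventually.of_forall fun ω => by
      by_cases h : ω ∈ A <;> simp [h])

open scoped Classical in
theorem LInf.exists_piecewise (hn : n ≤ m0) {A : Set Ω} (hA : MeasurableSet[n] A)
    (X Y : LInf n P) :
    ∃ W : LInf n P, ∀ᵐ ω ∂P, W.1 ω = if ω ∈ A then X.1 ω else Y.1 ω := by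
  refine LInf.exists_coeFn_eq hn (f := fun ω => if ω ∈ A then X.1 ω else Y.1 ω)
    (c := max ‖X‖ ‖Y‖) ?_ ?_
  · refine ⟨A.piecewise (LInf.aestronglyMeasurable X).mk (LInf.aestronglyMeasurable Y).mk,
      (LInf.aestronglyMeasurable X).stronglyMeasurable_mk.piecewise hA
        (LInf.aestronglyMeasurable Y).stronglyMeasurable_mk, ?_⟩
    filter_upwards [(LInf.aestronglyMeasurable X).ae_eq_mk, (LInf.aestronglyMeasurable Y).ae_eq_mk]
      with ω h1 h2
    simp [Set.piecewise, h1, h2]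
  · filter_upwards [LInf.ae_abs_le X, LInf.ae_abs_le Y] with ω h1 h2
    split_ifs
    · exact h1.trans (le_max_left _ _)
    · exact h2.trans (le_max_right _ _)

namespace IsConditionalRiskMeasure

variable {h : m ≤ n} {ρ : LInf n P → LInf m P}

/-- If `X ≤ Y + Z` for an `m`-measurable `Z`, then `ρ(Y) ≤ ρ(X) + Z`. -/
theorem le_add (hρ : IsConditionalRiskMeasure h ρ) {X Y : LInf n P} {Z : LInf m P}
    (hXY : ∀ᵐ ω ∂P, X.1 ω ≤ Y.1 ω + Z.1 ω) : ∀ᵐ ω ∂P, (ρ Y).1 ω ≤ (ρ X).1 ω + Z.1 ω := by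
  have h1 : X ≤ Y + LInf.incl h Z := by
    rw [LInf.le_iff]
    filter_upwards [hXY, LInf.coeFn_add Y (LInf.incl h Z)] with ω h1 h2
    rw [h2]
    exact h1
  have h2 := hρ.monotone _ _ h1
  rw [hρ.translation, LInf.le_iff] at h2
  filter_upwards [h2, LInf.coeFn_sub (ρ Y) Z] with ω h3 h4
  rw [h4] at h3
  linarith

theorem antitone (hρ : IsConditionalRiskMeasure h ρ) {X Y : LInf n P}
    (hXY : ∀ᵐ ω ∂P, X.1 ω ≤ Y.1 ω) : ∀ᵐ ω ∂P, (ρ Y).1 ω ≤ (ρ X).1 ω :=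
  (LInf.le_iff _ _).1 (hρ.monotone _ _ ((LInf.le_iff _ _).2 hXY))

theorem sub_norm_le (hm : m ≤ m0) (hρ : IsConditionalRiskMeasure h ρ) (X Y : LInf n P) :
    ∀ᵐ ω ∂P, (ρ X).1 ω - ‖Y‖ ≤ (ρ (X + Y)).1 ω := by
  obtain ⟨Z, hZ⟩ := LInf.exists_const hm P ‖Y‖
  have := hρ.le_add (X := X + Y) (Y := X) (Z := Z) (by
    filter_upwards [LInf.coeFn_add X Y, hZ, LInf.ae_abs_le Y] with ω h1 h2 h3
    rw [h1, h2]
    linarith [le_abs_self (Y.1 ω)])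
  filter_upwards [this, hZ] with ω h1 h2
  linarith

theorem abs_sub_le (hm : m ≤ m0) (hρ : IsConditionalRiskMeasure h ρ) (X Y : LInf n P) :
    ∀ᵐ ω ∂P, |(ρ (X + Y)).1 ω - (ρ X).1 ω| ≤ ‖Y‖ := by
  have := hρ.sub_norm_le hm (X + Y) (-Y)
  rw [add_neg_cancel_right, norm_neg] at this
  filter_upwards [hρ.sub_norm_le hm X Y, this] with ω h1 h2
  exact abs_le.2 ⟨by linarith, by linarith⟩

theorem le_of_eq_on (hm : m ≤ m0) (hρ : IsConditionalRiskMeasure h ρ) {A : Set Ω}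
    (hA : MeasurableSet[m] A) {X Y : LInf n P} (hXY : ∀ᵐ ω ∂P, ω ∈ A → X.1 ω = Y.1 ω) :
    ∀ᵐ ω ∂P, ω ∈ A → (ρ Y).1 ω ≤ (ρ X).1 ω := by
  obtain ⟨Z, hZ⟩ := LInf.exists_indicator hm P hA.compl (‖X‖ + ‖Y‖)
  have := hρ.le_add (X := X) (Y := Y) (Z := Z) (by
    filter_upwards [hZ, LInf.ae_abs_le X, LInf.ae_abs_le Y, hXY] with ω h1 h2 h3 h4
    rw [h1]
    by_cases hω : ω ∈ A
    · simp [hω, h4 hω]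
    · simp only [Set.mem_compl_iff, hω, not_false_eq_true, Set.indicator_of_mem]
      linarith [le_abs_self (X.1 ω), neg_abs_le (Y.1 ω)])
  filter_upwards [this, hZ] with ω h1 h2 hω
  rw [h2] at h1
  simpa [hω] using h1

/-- Locality: on an `m`-measurable event, `ρ(X)` depends only on the values of `X` there. This
follows from monotonicity and translation invariance alone, the translation being by a large
constant off the event. -/
theorem eq_of_eq_on (hm : m ≤ m0) (hρ : IsConditionalRiskMeasure h ρ) {A : Set Ω}
    (hA : MeasurableSet[m] A) {X Y : LInf n P} (hXY : ∀ᵐ ω ∂P, ω ∈ A → X.1 ω = Y.1 ω) :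
    ∀ᵐ ω ∂P, ω ∈ A → (ρ X).1 ω = (ρ Y).1 ω := by
  filter_upwards [hρ.le_of_eq_on hm hA hXY,
    hρ.le_of_eq_on hm hA (hXY.mono fun ω h hω => (h hω).symm)] with ω h1 h2 hω
  exact le_antisymm (h2 hω) (h1 hω)

theorem convex_ae (hρ : IsConditionalRiskMeasure h ρ) (X Y : LInf n P) {a b : ℝ} (ha : 0 ≤ a)
    (hb : 0 ≤ b) (hab : a + b = 1) :
    ∀ᵐ ω ∂P, (ρ (a • X + b • Y)).1 ω ≤ a * (ρ X).1 ω + b * (ρ Y).1 ω := by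
  obtain rfl : b = 1 - a := by linarith
  filter_upwards [(LInf.le_iff _ _).1 (hρ.convex X Y a ha (by linarith)),
    LInf.coeFn_add (a • ρ X) ((1 - a) • ρ Y), LInf.coeFn_smul a (ρ X),
    LInf.coeFn_smul (1 - a) (ρ Y)] with ω h1 h2 h3 h4
  rwa [h2, h3, h4] at h1

end IsConditionalRiskMeasure

end Basic

section Composition

variable {Ω : Type*} {m1 m2 m3 m0 : MeasurableSpace Ω} {P : Measure Ω} {h12 : m1 ≤ m2}
  {h23 : m2 ≤ m3} {ρ12 : LInf m2 P → LInf m1 P} {ρ23 : LInf m3 P → LInf m2 P}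

theorem IsConditionalRiskMeasure.comp (h1 : IsConditionalRiskMeasure h12 ρ12)
    (h2 : IsConditionalRiskMeasure h23 ρ23) :
    IsConditionalRiskMeasure (h12.trans h23) fun X => ρ12 (-ρ23 X) where
  monotone X Y hXY := by
    refine h1.monotone _ _ ((LInf.le_iff _ _).2 ?_)
    filter_upwards [h2.antitone ((LInf.le_iff _ _).1 hXY), LInf.coeFn_neg (ρ23 X),
      LInf.coeFn_neg (ρ23 Y)] with ω h3 h4 h5
    rw [h4, h5]
    exact neg_le_neg h3
  translation Z X := by
    have : LInf.incl (P := P) (h12.trans h23) Z = LInf.incl h23 (LInf.incl h12 Z) := rfl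
    rw [this, h2.translation, neg_sub, sub_eq_neg_add, h1.translation]
  convex X Y c hc0 hc1 := by
    refine le_trans (h1.monotone (c • -ρ23 X + (1 - c) • -ρ23 Y) _ ((LInf.le_iff _ _).2 ?_))
      (h1.convex _ _ c hc0 hc1)
    filter_upwards [h2.convex_ae X Y hc0 (sub_nonneg.2 hc1) (by ring),
      LInf.coeFn_add (c • -ρ23 X) ((1 - c) • -ρ23 Y), LInf.coeFn_smul c (-ρ23 X),
      LInf.coeFn_smul (1 - c) (-ρ23 Y), LInf.coeFn_neg (ρ23 X), LInf.coeFn_neg (ρ23 Y),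
      LInf.coeFn_neg (ρ23 (c • X + (1 - c) • Y))] with ω e1 e2 e3 e4 e5 e6 e7
    rw [e2, e3, e4, e5, e6, e7]
    linarith

theorem ContinuousFromAbove.comp (h2 : IsConditionalRiskMeasure h23 ρ23)
    (c1 : ContinuousFromAbove ρ12) (c2 : ContinuousFromAbove ρ23) :
    ContinuousFromAbove fun X => ρ12 (-ρ23 X) := by
  intro X Y hX hXY
  refine c1 (fun k => -ρ23 (X k)) (-ρ23 Y) (fun i j hij => (LInf.le_iff _ _).2 ?_) ?_
  · filter_upwards [h2.antitone ((LInf.le_iff _ _).1 (hX hij)), LInf.coeFn_neg (ρ23 (X i)),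
      LInf.coeFn_neg (ρ23 (X j))] with ω h3 h4 h5
    rw [h4, h5]
    exact neg_le_neg h3
  · filter_upwards [c2 X Y hX hXY, ae_all_iff.2 fun k => LInf.coeFn_neg (ρ23 (X k)),
      LInf.coeFn_neg (ρ23 Y)] with ω h3 h4 h5
    simp only [h4, h5]
    exact h3.neg

/-- The composition property is equivalent to the decomposition of the acceptance sets. Only the
acceptance sets for `Q = P` are needed to recover the composition property. -/
theorem composition_iff_acceptanceDecomposition [IsProbabilityMeasure P]
    {ρ13 : LInf m3 P → LInf m1 P} (r12 : IsConditionalRiskMeasure h12 ρ12)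
    (r23 : IsConditionalRiskMeasure h23 ρ23)
    (r13 : IsConditionalRiskMeasure (h12.trans h23) ρ13) :
    Composition ρ12 ρ23 ρ13 ↔ AcceptanceDecomposition h23 ρ12 ρ23 ρ13 := by
  have hacc : ∀ X : LInf m3 P, ρ23 (X + LInf.incl h23 (ρ23 X)) = 0 := fun X => by
    rw [r23.translation, sub_self]
  constructor
  · intro hc Q _ hQ
    ext Y
    constructor
    · intro hY
      refine Set.mem_add.2 ⟨LInf.incl h23 (-ρ23 Y), ⟨-ρ23 Y, ?_, rfl⟩,
        Y + LInf.incl h23 (ρ23 Y), ?_, ?_⟩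
      · change ∀ᵐ ω ∂Q, _
        rw [← hc Y]
        exact hY
      · change ∀ᵐ ω ∂P, _
        rw [hacc]
        filter_upwards [LInf.coeFn_zero (n := m2) (P := P)] with ω hω
        exact hω.le
      · rw [map_neg]
        abel
    · intro hY
      obtain ⟨_, ⟨U, hU, rfl⟩, W, hW, rfl⟩ := Set.mem_add.1 hY
      change ∀ᵐ ω ∂Q, _
      rw [hc]
      have h1 : ∀ᵐ ω ∂P, U.1 ω ≤ (-ρ23 (LInf.incl h23 U + W)).1 ω := by
        rw [add_comm, r23.translation]
        filter_upwards [hW, LInf.coeFn_neg (ρ23 W - U), LInf.coeFn_sub (ρ23 W) U]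
          with ω e1 e2 e3
        rw [e2, e3]
        linarith
      filter_upwards [hQ.ae_le (r12.antitone h1), hU] with ω e1 e2 using e1.trans e2
  · intro hd X
    have hP := hd P inferInstance Measure.AbsolutelyContinuous.rfl
    refine le_antisymm ?_ ?_
    · -- `X + ρ12 (-ρ23 X)` is accepted, being the sum of two accepted positions
      set Z := ρ12 (-ρ23 X) with hZ
      have hmem : X + LInf.incl (h12.trans h23) Z ∈ acceptanceSet ρ13 P := by
        rw [hP]
        refine Set.mem_add.2 ⟨LInf.incl h23 (-ρ23 X + LInf.incl h12 Z), ⟨_, ?_, rfl⟩,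
          X + LInf.incl h23 (ρ23 X), ?_, ?_⟩
        · change ∀ᵐ ω ∂P, _
          rw [r12.translation, ← hZ, sub_self]
          filter_upwards [LInf.coeFn_zero (n := m1) (P := P)] with ω hω using hω.le
        · change ∀ᵐ ω ∂P, _
          rw [hacc]
          filter_upwards [LInf.coeFn_zero (n := m2) (P := P)] with ω hω using hω.le
        · have : LInf.incl (P := P) (h12.trans h23) Z = LInf.incl h23 (LInf.incl h12 Z) := rfl
          rw [this, map_add, map_neg]
          abel
      change ∀ᵐ ω ∂P, _ at hmem
      rw [r13.translation] at hmem
      rw [LInf.le_iff]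
      filter_upwards [hmem, LInf.coeFn_sub (ρ13 X) Z] with ω e1 e2
      rw [e2] at e1
      linarith
    · -- `X + ρ13 X` is accepted, hence a sum of two accepted positions
      set Z := ρ13 X with hZ
      have hmem : X + LInf.incl (h12.trans h23) Z ∈ acceptanceSet ρ13 P := by
        change ∀ᵐ ω ∂P, _
        rw [r13.translation, ← hZ, sub_self]
        filter_upwards [LInf.coeFn_zero (n := m1) (P := P)] with ω hω using hω.le
      rw [hP] at hmem
      obtain ⟨_, ⟨U, hU, rfl⟩, W, hW, hUW⟩ := Set.mem_add.1 hmem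
      have e : LInf.incl (P := P) (h12.trans h23) Z = LInf.incl h23 (LInf.incl h12 Z) := rfl
      have h1 : ρ23 W - U = ρ23 X - LInf.incl h12 Z := by
        rw [← r23.translation, ← r23.translation, ← e, ← hUW, add_comm]
      have h2 : ∀ᵐ ω ∂P, U.1 ω ≤ (-ρ23 X + LInf.incl h12 Z).1 ω := by
        have : -ρ23 X + LInf.incl h12 Z = U - ρ23 W := by
          rw [← neg_sub (ρ23 W), h1]
          abel
        rw [this]
        filter_upwards [hW, LInf.coeFn_sub U (ρ23 W)] with ω e1 e2
        rw [e2]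
        linarith
      have h3 := r12.antitone h2
      rw [r12.translation] at h3
      rw [LInf.le_iff]
      filter_upwards [h3, hU, LInf.coeFn_sub (ρ12 (-ρ23 X)) Z] with ω e1 e2 e3
      rw [e3] at e1
      linarith

end Composition

/-! ### Representation by absolutely continuous probability measures -/

theorem tendsto_ciSup_tail {a : ℕ → ℝ} {l : ℝ} (h : Tendsto a atTop (𝓝 l)) :
    Tendsto (fun j => ⨆ i, a (j + i)) atTop (𝓝 l) := by
  have hb : ∀ j, BddAbove (Set.range fun i => a (j + i)) := fun j =>
    h.bddAbove_range.mono (by rintro _ ⟨i, rfl⟩; exact ⟨j + i, rfl⟩)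
  refine tendsto_of_tendsto_of_tendsto_of_le_of_le' h
    (tendsto_order.2 ⟨fun c hc => ?_, fun c hc => ?_⟩ :
      Tendsto (fun j => ⨆ i, a (j + i)) atTop (𝓝 l))
    (Eventually.of_forall fun j => le_ciSup_of_le (hb j) 0 le_rfl)
    (Eventually.of_forall fun j => le_rfl)
  · filter_upwards [h.eventually (lt_mem_nhds hc)] with j hj
    exact hj.trans_le (le_ciSup_of_le (hb j) 0 le_rfl)
  · obtain ⟨d, hd, hdc⟩ := exists_between hc
    obtain ⟨N, hN⟩ := eventually_atTop.1 (h.eventually (gt_mem_nhds hd))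
    filter_upwards [eventually_ge_atTop N] with j hj
    exact (ciSup_le fun i => (hN (j + i) (by omega)).le).trans_lt hdc

section Representation

variable {Ω : Type*} {m n m0 : MeasurableSpace Ω} {P : Measure Ω}

theorem LInf.memLp (hn : n ≤ m0) [IsFiniteMeasure P] (X : LInf n P) (p : ℝ≥0∞) :
    MemLp X.1 p P :=
  MemLp.of_bound ((LInf.aestronglyMeasurable X).mono hn) ‖X‖ (by simpa using LInf.ae_abs_le X)

/-- The inclusion of `L^∞(n)` into `L^2`. -/
noncomputable def LInf.toL2 (hn : n ≤ m0) (P : Measure Ω) [IsProbabilityMeasure P] :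
    LInf n P →L[ℝ] Lp ℝ 2 P :=
  LinearMap.mkContinuous
    { toFun := fun X => (LInf.memLp hn X 2).toLp X.1
      map_add' := fun X Y => by
        refine Lp.ext ?_
        filter_upwards [(LInf.memLp hn (X + Y) 2).coeFn_toLp, (LInf.memLp hn X 2).coeFn_toLp,
          (LInf.memLp hn Y 2).coeFn_toLp, LInf.coeFn_add X Y,
          Lp.coeFn_add ((LInf.memLp hn X 2).toLp X.1) ((LInf.memLp hn Y 2).toLp Y.1)]
          with ω h1 h2 h3 h4 h5
        rw [h1, h4, h5, Pi.add_apply, h2, h3]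
      map_smul' := fun c X => by
        refine Lp.ext ?_
        filter_upwards [(LInf.memLp hn (c • X) 2).coeFn_toLp, (LInf.memLp hn X 2).coeFn_toLp,
          LInf.coeFn_smul c X, Lp.coeFn_smul c ((LInf.memLp hn X 2).toLp X.1)]
          with ω h1 h2 h3 h4
        rw [h1, h3, RingHom.id_apply, h4, Pi.smul_apply, h2, smul_eq_mul] }
    1 fun X => by
      have h := Lp.norm_le_of_ae_bound (p := 2) (μ := P) (f := (LInf.memLp hn X 2).toLp X.1)
        (norm_nonneg X) (by
          filter_upwards [(LInf.memLp hn X 2).coeFn_toLp, LInf.ae_abs_le X] with ω h1 h2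
          rw [h1]
          exact h2)
      simpa [measureUnivNNReal] using h

theorem LInf.coeFn_toL2 (hn : n ≤ m0) [IsProbabilityMeasure P] (X : LInf n P) :
    ∀ᵐ ω ∂P, LInf.toL2 hn P X ω = X.1 ω :=
  (LInf.memLp hn X 2).coeFn_toLp

theorem LInf.toL2_injective (hn : n ≤ m0) [IsProbabilityMeasure P] :
    Function.Injective (LInf.toL2 (n := n) hn P) := by
  intro X Y h
  refine LInf.ext_ae ?_
  filter_upwards [LInf.coeFn_toL2 hn X, LInf.coeFn_toL2 hn Y] with ω h1 h2
  rw [← h1, ← h2, h]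

theorem integral_condExp_mul (hn : n ≤ m0) [IsProbabilityMeasure P] {g : Ω → ℝ}
    (hg : Integrable g P) (X : LInf n P) :
    ∫ ω, (P[g | n]) ω * X.1 ω ∂P = ∫ ω, g ω * X.1 ω ∂P := by
  set f := (LInf.aestronglyMeasurable X).mk
  have hf := (LInf.aestronglyMeasurable X).stronglyMeasurable_mk
  have hfX := (LInf.aestronglyMeasurable X).ae_eq_mk
  have hb : ∀ᵐ ω ∂P, ‖f ω‖ ≤ ‖X‖ := by
    filter_upwards [hfX, LInf.ae_abs_le X] with ω h1 h2
    rwa [h1] at h2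
  have h1 := condExp_stronglyMeasurable_mul_of_bound hn hf hg ‖X‖ hb
  calc ∫ ω, (P[g | n]) ω * X.1 ω ∂P = ∫ ω, (P[f * g | n]) ω ∂P := by
        refine integral_congr_ae ?_
        filter_upwards [h1, hfX] with ω e1 e2
        rw [e1, Pi.mul_apply, e2, mul_comm]
    _ = ∫ ω, (f * g) ω ∂P := integral_condExp hn
    _ = _ := by
        refine integral_congr_ae ?_
        filter_upwards [hfX] with ω e2
        rw [Pi.mul_apply, e2, mul_comm]

theorem inner_toL2 (hn : n ≤ m0) [IsProbabilityMeasure P] (g : Lp ℝ 2 P) (X : LInf n P) :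
    inner ℝ g (LInf.toL2 hn P X) = ∫ ω, (P[g | n]) ω * X.1 ω ∂P := by
  rw [integral_condExp_mul hn ((Lp.memLp g).integrable (by norm_num)), L2.inner_def]
  refine integral_congr_ae ?_
  filter_upwards [LInf.coeFn_toL2 hn X] with ω h
  rw [h]
  simp [mul_comm]

/-- The dual norm of `L^∞(n)` on the functionals given by `L^2` densities is the `L^1` norm of
the conditional expectation of the density. -/
theorem integral_norm_condExp_le (hn : n ≤ m0) [IsProbabilityMeasure P] (g : Lp ℝ 2 P) {c : ℝ}
    (hc0 : 0 ≤ c) (hc : ∀ X, |inner ℝ g (LInf.toL2 (n := n) hn P X)| ≤ c * ‖X‖) :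
    ∫ ω, ‖(P[g | n]) ω‖ ∂P ≤ c := by
  have hD : StronglyMeasurable[n] (P[g | n]) := stronglyMeasurable_condExp
  classical
  obtain ⟨X, hX⟩ := LInf.exists_coeFn_eq (P := P) hn
    (f := fun ω => if ω ∈ (P[g | n]) ⁻¹' Set.Ici 0 then (1 : ℝ) else -1) (c := 1)
    (Measurable.ite (hD.measurable measurableSet_Ici) measurable_const
      measurable_const).stronglyMeasurable.aestronglyMeasurable
    (Eventually.of_forall fun ω => by split_ifs <;> simp)
  have hX1 : ‖X‖ ≤ 1 := LInf.norm_le zero_le_one (by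
    filter_upwards [hX] with ω h
    rw [h]
    split_ifs <;> simp)
  have h1 : ∫ ω, ‖(P[g | n]) ω‖ ∂P = inner ℝ g (LInf.toL2 hn P X) := by
    rw [inner_toL2]
    refine integral_congr_ae ?_
    filter_upwards [hX] with ω h
    rw [h, Real.norm_eq_abs]
    by_cases h0 : 0 ≤ (P[g | n]) ω
    · simp [h0, abs_of_nonneg h0]
    · simp [h0, abs_of_neg (not_le.1 h0)]
  rw [h1]
  exact (le_abs_self _).trans ((hc X).trans (mul_le_of_le_one_right hc0 hX1))

variable {h : m ≤ n} {ρ : LInf n P → LInf m P}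

/-- For a conditional risk measure that is continuous from above, the expected risk is lower
semicontinuous on balls for the `L^2` topology: a convergent sequence is dominated by the
decreasing sequence of its tail suprema. -/
theorem lscOnBalls_integral (hm : m ≤ m0) (hn : n ≤ m0) [IsProbabilityMeasure P]
    (hρ : IsConditionalRiskMeasure h ρ) (hc : ContinuousFromAbove ρ) {S : Measure Ω}
    [IsProbabilityMeasure S] (hS : S ≪ P) (X : LInf n P) :
    LscOnBalls (LInf.toL2 hn P) fun Y => (∫ ω, (ρ (X + Y)).1 ω ∂S) - ∫ ω, (ρ X).1 ω ∂S := by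
  intro r v y hv hy
  have hr : 0 ≤ r := (norm_nonneg _).trans (hv 0)
  obtain ⟨ns, hns, hlim⟩ := (tendstoInMeasure_of_tendsto_Lp hy).exists_seq_tendsto_ae
  have hlim' : ∀ᵐ ω ∂P, Tendsto (fun i => (v (ns i)).1 ω) atTop (𝓝 (y ω)) := by
    filter_upwards [hlim, ae_all_iff.2 fun i => LInf.coeFn_toL2 hn (v (ns i))] with ω h1 h2
    simpa only [h2] using h1
  have hvb : ∀ᵐ ω ∂P, ∀ k, |(v k).1 ω| ≤ r :=
    ae_all_iff.2 fun k => (LInf.ae_abs_le (v k)).mono fun ω h => h.trans (hv k)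
  have hym : AEStronglyMeasurable[n] y P := by
    refine (isClosed_aestronglyMeasurable (F := ℝ) (p := 2) (μ := P) hn).mem_of_tendsto hy
      (Eventually.of_forall fun k => ?_)
    exact (LInf.aestronglyMeasurable (v k)).congr
      (Filter.EventuallyEq.symm (LInf.coeFn_toL2 hn (v k)))
  have hyb : ∀ᵐ ω ∂P, |y ω| ≤ r := by
    filter_upwards [hlim', hvb] with ω h1 h2
    exact le_of_tendsto' h1.abs fun i => h2 _
  obtain ⟨u, hu⟩ := LInf.exists_coeFn_eq hn hym hyb
  refine ⟨u, LInf.norm_le hr ?_, ?_, fun c hcv => ?_⟩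
  · filter_upwards [hu, hyb] with ω h1 h2
    rwa [h1]
  · refine Lp.ext ?_
    filter_upwards [hu, LInf.coeFn_toL2 hn u] with ω h1 h2
    rw [h2, h1]
  -- the tail suprema of the subsequence decrease to its limit and dominate its members
  have hw : ∀ j, ∃ Z : LInf n P, ∀ᵐ ω ∂P, Z.1 ω = ⨆ i, (v (ns (j + i))).1 ω := by
    intro j
    have hmk : ∀ᵐ ω ∂P, ∀ i, (v i).1 ω = (LInf.aestronglyMeasurable (v i)).mk _ ω :=
      ae_all_iff.2 fun i => (LInf.aestronglyMeasurable (v i)).ae_eq_mk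
    refine LInf.exists_coeFn_eq hn (c := r) ?_ ?_
    · refine ⟨fun ω => ⨆ i, (LInf.aestronglyMeasurable (v (ns (j + i)))).mk _ ω,
        (Measurable.iSup fun i =>
          (LInf.aestronglyMeasurable (v (ns (j + i)))).stronglyMeasurable_mk.measurable
          ).stronglyMeasurable, ?_⟩
      filter_upwards [hmk] with ω h1
      simp only [h1]
    · filter_upwards [hvb] with ω h1
      refine abs_le.2 ⟨?_, ciSup_le fun i => (abs_le.1 (h1 _)).2⟩
      exact (abs_le.1 (h1 (ns (j + 0)))).1.trans
        (le_ciSup (f := fun i => (v (ns (j + i))).1 ω)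
          ⟨r, by rintro _ ⟨i, rfl⟩; exact (abs_le.1 (h1 _)).2⟩ 0)
  choose Z hZ using hw
  have hbdd : ∀ᵐ ω ∂P, ∀ j, BddAbove (Set.range fun i => (v (ns (j + i))).1 ω) := by
    filter_upwards [hvb] with ω h1 j
    exact ⟨r, by rintro _ ⟨i, rfl⟩; exact (abs_le.1 (h1 _)).2⟩
  have hZr : ∀ j, ‖Z j‖ ≤ r := fun j => LInf.norm_le hr (by
    filter_upwards [hvb, hZ j, hbdd] with ω h1 h2 h3
    rw [h2]
    exact abs_le.2 ⟨(abs_le.1 (h1 (ns (j + 0)))).1.trans (le_ciSup (h3 j) 0),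
      ciSup_le fun i => (abs_le.1 (h1 _)).2⟩)
  have hanti : Antitone fun j => X + Z j := by
    intro i j hij
    refine (LInf.le_iff _ _).2 ?_
    filter_upwards [hZ i, hZ j, hbdd, LInf.coeFn_add X (Z i), LInf.coeFn_add X (Z j)]
      with ω h1 h2 h3 h4 h5
    rw [h4, h5, h1, h2]
    refine add_le_add_right (ciSup_le fun k => ?_) _
    have := le_ciSup (h3 i) (j - i + k)
    rwa [show i + (j - i + k) = j + k by omega] at this
  have hZlim : ∀ᵐ ω ∂P, Tendsto (fun j => (X + Z j).1 ω) atTop (𝓝 ((X + u).1 ω)) := by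
    filter_upwards [hlim', ae_all_iff.2 hZ, hu, LInf.coeFn_add X u,
      ae_all_iff.2 fun j => LInf.coeFn_add X (Z j)] with ω h1 h2 h3 h4 h5
    simp only [h4, h5, h3, h2]
    exact (tendsto_ciSup_tail h1).const_add _
  have hρlim := hS.ae_le (hc _ _ hanti hZlim)
  have hint : Tendsto (fun j => ∫ ω, (ρ (X + Z j)).1 ω ∂S) atTop
      (𝓝 (∫ ω, (ρ (X + u)).1 ω ∂S)) := by
    refine tendsto_integral_of_dominated_convergence (fun _ => ‖ρ X‖ + r)
      (fun j => (LInf.integrable hm hS _).aestronglyMeasurable) (integrable_const _)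
      (fun j => ?_) hρlim
    have h1 : ∀ᵐ ω ∂P, ‖(ρ (X + Z j)).1 ω‖ ≤ ‖ρ X‖ + r := by
      filter_upwards [hρ.abs_sub_le hm X (Z j), LInf.ae_abs_le (ρ X)] with ω e1 e2
      have e3 := abs_add_le ((ρ (X + Z j)).1 ω - (ρ X).1 ω) ((ρ X).1 ω)
      rw [sub_add_cancel] at e3
      rw [Real.norm_eq_abs]
      linarith [hZr j]
    exact hS.ae_le h1
  refine le_of_tendsto (hint.sub_const _) ?_
  filter_upwards [hns.tendsto_atTop.eventually hcv] with j hj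
  refine le_trans (sub_le_sub_right (integral_mono_ae (LInf.integrable hm hS _)
    (LInf.integrable hm hS _) (hS.ae_le ?_)) _) hj
  refine hρ.antitone ?_
  filter_upwards [hZ j, hbdd, LInf.coeFn_add X (Z j), LInf.coeFn_add X (v (ns j))]
    with ω h1 h2 h3 h4
  rw [h3, h4, h1]
  exact add_le_add_right (le_ciSup (h2 j) 0) _

/-- A conditional risk measure that is continuous from above has, at every `X` and after
integration against `S`, an `ε`-subgradient given by an integrable density. -/
theorem exists_density_minorant (hm : m ≤ m0) (hn : n ≤ m0) [IsProbabilityMeasure P]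
    (hρ : IsConditionalRiskMeasure h ρ) (hc : ContinuousFromAbove ρ) {S : Measure Ω}
    [IsProbabilityMeasure S] (hS : S ≪ P) (X : LInf n P) {ε : ℝ} (hε : 0 < ε) :
    ∃ D : Ω → ℝ, StronglyMeasurable[n] D ∧ Integrable D P ∧ ∀ Y : LInf n P,
      (∫ ω, D ω * Y.1 ω ∂P) - ε ≤ (∫ ω, (ρ (X + Y)).1 ω ∂S) - ∫ ω, (ρ X).1 ω ∂S := by
  set ψ : LInf n P → ℝ := fun Y => (∫ ω, (ρ (X + Y)).1 ω ∂S) - ∫ ω, (ρ X).1 ω ∂S with hψ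
  have hcv : ConvexOn ℝ Set.univ ψ := by
    refine ⟨convex_univ, fun Y _ Z _ a b ha hb hab => ?_⟩
    have e : X + (a • Y + b • Z) = a • (X + Y) + b • (X + Z) := by
      rw [smul_add, smul_add, add_add_add_comm, ← add_smul, hab, one_smul]
    have h1 : ∫ ω, (ρ (X + (a • Y + b • Z))).1 ω ∂S ≤
        ∫ ω, (a * (ρ (X + Y)).1 ω + b * (ρ (X + Z)).1 ω) ∂S := by
      rw [e]
      exact integral_mono_ae (LInf.integrable hm hS _)
        (((LInf.integrable hm hS _).const_mul a).add ((LInf.integrable hm hS _).const_mul b))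
        (hS.ae_le (hρ.convex_ae _ _ ha hb hab))
    rw [integral_add ((LInf.integrable hm hS _).const_mul a)
      ((LInf.integrable hm hS _).const_mul b), integral_const_mul, integral_const_mul] at h1
    simp only [hψ, smul_eq_mul]
    have h2 : (a + b) * ∫ ω, (ρ X).1 ω ∂S = ∫ ω, (ρ X).1 ω ∂S := by rw [hab, one_mul]
    linarith
  have hψ0 : ψ 0 = 0 := by simp [hψ]
  have hlow : ∀ Y, -‖Y‖ ≤ ψ Y := by
    intro Y
    have h1 := integral_mono_ae ((LInf.integrable hm hS (ρ X)).sub (integrable_const ‖Y‖))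
      (LInf.integrable hm hS (ρ (X + Y))) (hS.ae_le (hρ.sub_norm_le hm X Y))
    simp only [Pi.sub_apply] at h1
    rw [integral_sub (LInf.integrable hm hS (ρ X)) (integrable_const ‖Y‖)] at h1
    simp only [integral_const, probReal_univ, one_smul] at h1
    simp only [hψ]
    linarith
  obtain ⟨g, hg1, hg2⟩ := exists_seq_inner_minorant (LInf.toL2_injective hn) hcv hψ0
    (lscOnBalls_integral hm hn hρ hc hS X) hlow hε
  let F : ℕ → Lp ℝ 1 P := fun k => (integrable_condExp (m := n) (f := g k) (μ := P)).toL1 _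
  have hF : ∀ k, ∀ᵐ ω ∂P, F k ω = (P[g k | n]) ω := fun k => Integrable.coeFn_toL1 _
  have hgi : ∀ k, Integrable (g k) P := fun k => (Lp.memLp (g k)).integrable (by norm_num)
  have hFc : CauchySeq F := by
    refine cauchySeq_of_le_geometric (1 / 2) 2 (by norm_num) fun k => ?_
    have h1 := integral_norm_condExp_le hn (g (k + 1) - g k) (by positivity) (hg1 k)
    rw [dist_comm, dist_eq_norm, L1.norm_eq_integral_norm]
    refine le_of_eq_of_le (integral_congr_ae ?_) h1
    have h2 : P[((g (k + 1) - g k : Lp ℝ 2 P) : Ω → ℝ) | n] =ᵐ[P]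
        P[(g (k + 1) : Ω → ℝ) - g k | n] := condExp_congr_ae (Lp.coeFn_sub _ _)
    filter_upwards [hF k, hF (k + 1), Lp.coeFn_sub (F (k + 1)) (F k), h2,
      condExp_sub (hgi (k + 1)) (hgi k) n] with ω e1 e2 e3 e4 e5
    rw [e3, e4, e5, Pi.sub_apply, Pi.sub_apply, e1, e2]
  obtain ⟨G, hG⟩ := cauchySeq_tendsto_of_complete hFc
  have hGi : Integrable G P := L1.integrable_coeFn G
  refine ⟨P[G | n], stronglyMeasurable_condExp, integrable_condExp, fun Y => ?_⟩
  rw [integral_condExp_mul hn hGi]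
  have hmulY : ∀ {f : Ω → ℝ}, Integrable f P → Integrable (fun ω => f ω * Y.1 ω) P :=
    fun hf => hf.mul_bdd (c := ‖Y‖) ((LInf.aestronglyMeasurable Y).mono hn)
      (by simpa using LInf.ae_abs_le Y)
  have hlim : Tendsto (fun k => ∫ ω, F k ω * Y.1 ω ∂P) atTop (𝓝 (∫ ω, G ω * Y.1 ω ∂P)) := by
    rw [tendsto_iff_norm_sub_tendsto_zero] at hG ⊢
    refine squeeze_zero (fun _ => norm_nonneg _) (fun k => ?_)
      (by simpa using hG.mul_const ‖Y‖)
    rw [← integral_sub (hmulY (L1.integrable_coeFn _)) (hmulY hGi), L1.norm_eq_integral_norm,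
      ← integral_mul_const]
    refine (norm_integral_le_integral_norm _).trans (integral_mono_ae ?_ ?_ ?_)
    · exact ((hmulY (L1.integrable_coeFn _)).sub (hmulY hGi)).norm
    · exact (L1.integrable_coeFn _).norm.mul_const _
    · filter_upwards [Lp.coeFn_sub (F k) G, LInf.ae_abs_le Y] with ω e1 e2
      rw [e1, ← sub_mul, norm_mul, Pi.sub_apply]
      gcongr
      exact e2
  have hpow : Tendsto (fun k : ℕ => ψ Y + ε + (1 / 2 : ℝ) ^ k * ‖Y‖) atTop (𝓝 (ψ Y + ε)) := by
    simpa using ((tendsto_pow_atTop_nhds_zero_of_lt_one (by norm_num : (0 : ℝ) ≤ 1 / 2)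
      (by norm_num)).mul_const ‖Y‖).const_add (ψ Y + ε)
  have := le_of_tendsto_of_tendsto' hlim hpow fun k => by
    have h1 := hg2 k Y
    rw [inner_toL2] at h1
    have h2 : ∫ ω, F k ω * Y.1 ω ∂P = ∫ ω, (P[g k | n]) ω * Y.1 ω ∂P :=
      integral_congr_ae ((hF k).mono fun ω e => by simp only [e])
    rw [h2]
    linarith
  linarith

/-- The measures `Q` that attain, up to `ε`, the supremum in the dual representation of the
`S`-expected risk can be chosen to coincide with `S` on the conditioning `σ`-algebra. -/
theorem exists_measure_minorant (hm : m ≤ m0) (hn : n ≤ m0) [IsProbabilityMeasure P]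
    (hρ : IsConditionalRiskMeasure h ρ) (hc : ContinuousFromAbove ρ) {S : Measure Ω}
    [IsProbabilityMeasure S] (hS : S ≪ P) (X : LInf n P) {ε : ℝ} (hε : 0 < ε) :
    ∃ Q : Measure Ω, IsProbabilityMeasure Q ∧ Q ≪ P ∧
      (∀ Z : LInf m P, ∫ ω, Z.1 ω ∂Q = ∫ ω, Z.1 ω ∂S) ∧
      ∀ Y : LInf n P, -(∫ ω, Y.1 ω ∂Q) - ∫ ω, (ρ Y).1 ω ∂S ≤
        -(∫ ω, X.1 ω ∂Q) - (∫ ω, (ρ X).1 ω ∂S) + ε := by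
  obtain ⟨D, hDm, hDi, hD⟩ := exists_density_minorant hm hn hρ hc hS X hε
  have hscale : ∀ a b : ℝ, (∀ t : ℝ, 0 < t → t * a - ε ≤ t * b) → a ≤ b := by
    intro a b hab
    by_contra! hlt
    have := hab (2 * ε / (a - b)) (div_pos (by linarith) (by linarith))
    have h2 : 2 * ε / (a - b) * (a - b) = 2 * ε := div_mul_cancel₀ _ (by linarith)
    linarith
  have hsmul : ∀ (t : ℝ) (Y : LInf n P),
      ∫ ω, D ω * (t • Y).1 ω ∂P = t * ∫ ω, D ω * Y.1 ω ∂P := by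
    intro t Y
    rw [← integral_const_mul]
    refine integral_congr_ae ?_
    filter_upwards [LInf.coeFn_smul t Y] with ω e
    rw [e]
    ring
  -- the density is nonpositive by monotonicity
  have hD0 : ∀ᵐ ω ∂P, D ω ≤ 0 := by
    obtain ⟨Y, hY⟩ := LInf.exists_indicator hn P
      (hDm.measurable measurableSet_Ioi : MeasurableSet[n] (D ⁻¹' Set.Ioi 0)) 1
    have h1 : ∫ ω, D ω * Y.1 ω ∂P ≤ 0 := by
      refine hscale _ _ fun t ht => ?_
      rw [← hsmul, mul_zero]
      refine (hD _).trans (sub_nonpos.2 (integral_mono_ae (LInf.integrable hm hS _)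
        (LInf.integrable hm hS _) (hS.ae_le (hρ.antitone ?_))))
      filter_upwards [hY, LInf.coeFn_add X (t • Y), LInf.coeFn_smul t Y] with ω e1 e2 e3
      rw [e2, e3, e1]
      have : 0 ≤ (D ⁻¹' Set.Ioi 0).indicator (fun _ => (1 : ℝ)) ω :=
        Set.indicator_nonneg (fun _ _ => zero_le_one) ω
      nlinarith
    have h2 : ∀ᵐ ω ∂P, D ω * Y.1 ω = max (D ω) 0 := by
      filter_upwards [hY] with ω e
      rw [e]
      by_cases hω : 0 < D ω
      · simp [hω, hω.le]
      · simp [hω, not_lt.1 hω]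
    rw [integral_congr_ae h2] at h1
    have h3 := (integral_eq_zero_iff_of_nonneg (fun ω => le_max_right (D ω) 0) hDi.pos_part).1
      (le_antisymm h1 (integral_nonneg fun ω => le_max_right (D ω) 0))
    filter_upwards [h3] with ω e
    exact max_eq_right_iff.1 e
  let Q : Measure Ω := P.withDensity fun ω => ENNReal.ofReal (-D ω)
  have hQP : Q ≪ P := withDensity_absolutelyContinuous _ _
  have hQint : ∀ f : Ω → ℝ, ∫ ω, f ω ∂Q = -∫ ω, D ω * f ω ∂P := by
    intro f
    have hmeas : AEMeasurable (fun ω => ENNReal.ofReal (-D ω)) P :=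
      hDi.aestronglyMeasurable.aemeasurable.neg.ennreal_ofReal
    rw [show Q = P.withDensity fun ω => ENNReal.ofReal (-D ω) from rfl,
      integral_withDensity_eq_integral_toReal_smul₀ hmeas
      (Eventually.of_forall fun _ => ENNReal.ofReal_lt_top), ← integral_neg]
    refine integral_congr_ae ?_
    filter_upwards [hD0] with ω e
    rw [ENNReal.toReal_ofReal (by linarith), smul_eq_mul, neg_mul]
  -- translation invariance identifies `Q` on the conditioning `σ`-algebra
  have hZle : ∀ Z : LInf m P, ∫ ω, D ω * Z.1 ω ∂P ≤ -∫ ω, Z.1 ω ∂S := by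
    intro Z
    refine hscale _ _ fun t ht => ?_
    have h1 := hD (LInf.incl h (t • Z))
    rw [hρ.translation] at h1
    have h2 : ∫ ω, (ρ X - t • Z).1 ω ∂S = (∫ ω, (ρ X).1 ω ∂S) - t * ∫ ω, Z.1 ω ∂S := by
      rw [← integral_const_mul, ← integral_sub (LInf.integrable hm hS _)
        ((LInf.integrable hm hS _).const_mul t)]
      refine integral_congr_ae (hS.ae_le ?_)
      filter_upwards [LInf.coeFn_sub (ρ X) (t • Z), LInf.coeFn_smul t Z] with ω e1 e2
      rw [e1, e2]
    have h3 : ∫ ω, D ω * (LInf.incl h (t • Z)).1 ω ∂P = t * ∫ ω, D ω * Z.1 ω ∂P :=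
      hsmul t (LInf.incl h Z)
    rw [h2, h3] at h1
    linarith
  have hZeq : ∀ Z : LInf m P, ∫ ω, Z.1 ω ∂Q = ∫ ω, Z.1 ω ∂S := by
    intro Z
    have h1 := hZle Z
    have h2 := hZle (-Z)
    have h3 : ∫ ω, D ω * (-Z).1 ω ∂P = -∫ ω, D ω * Z.1 ω ∂P := by
      rw [← integral_neg]
      refine integral_congr_ae ?_
      filter_upwards [LInf.coeFn_neg Z] with ω e
      rw [e, mul_neg]
    have h4 : ∫ ω, (-Z).1 ω ∂S = -∫ ω, Z.1 ω ∂S := by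
      rw [← integral_neg]
      exact integral_congr_ae (hS.ae_le (LInf.coeFn_neg Z))
    rw [h3, h4] at h2
    rw [hQint]
    linarith
  have hQprob : IsProbabilityMeasure Q := by
    obtain ⟨Z, hZ⟩ := LInf.exists_const hm P 1
    have h1 := hZeq Z
    have h2 : ∫ ω, Z.1 ω ∂S = 1 := by
      rw [integral_congr_ae (g := fun _ => (1 : ℝ)) (hS.ae_le hZ)]
      simp
    have h3 : ∫ ω, Z.1 ω ∂Q = Q.real Set.univ := by
      rw [integral_congr_ae (g := fun _ => (1 : ℝ)) (hQP.ae_le hZ)]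
      simp
    rw [h3, h2, Measure.real, ENNReal.toReal_eq_one_iff] at h1
    exact ⟨h1⟩
  refine ⟨Q, hQprob, hQP, hZeq, fun Y => ?_⟩
  have h1 := hD (Y - X)
  rw [add_sub_cancel] at h1
  have h2 : ∫ ω, (Y - X).1 ω ∂Q = (∫ ω, Y.1 ω ∂Q) - ∫ ω, X.1 ω ∂Q := by
    rw [← integral_sub (LInf.integrable hn hQP _) (LInf.integrable hn hQP _)]
    exact integral_congr_ae (hQP.ae_le (LInf.coeFn_sub Y X))
  have h3 := hQint (Y - X).1
  linarith

end Representation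

/-! ### Essential suprema of directed families -/

section EssSup

variable {Ω : Type*} {m m0 : MeasurableSpace Ω}

/-- The essential supremum of a family is the supremum of a countable subfamily. -/
theorem IsFamilyEssSup.exists_countable {ι : Type*} {Q : Measure Ω} [IsProbabilityMeasure Q]
    {f : ι → Ω → EReal} {g : Ω → EReal} (hg : IsFamilyEssSup Q f g)
    (hf : ∀ i, AEMeasurable (f i) Q) :
    ∃ D : Set ι, D.Countable ∧ g =ᵐ[Q] fun ω => ⨆ i ∈ D, f i ω := by
  -- maximize over countable subfamilies the integral of a bounded increasing function
  set φ : EReal → ℝ≥0∞ := fun x => (1 + EReal.exp (-x))⁻¹ with hφ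
  have hφm : Measurable φ := ((EReal.measurable_exp.comp measurable_neg).const_add 1).inv
  have hφ1 : ∀ x, φ x ≤ 1 := fun x => ENNReal.inv_le_one.2 le_self_add
  let s : Set ι → Ω → EReal := fun C ω => ⨆ i ∈ C, f i ω
  let J : Set ι → ℝ≥0∞ := fun C => ∫⁻ ω, φ (s C ω) ∂Q
  have hs : ∀ C : Set ι, C.Countable → AEMeasurable (s C) Q :=
    fun C hC => AEMeasurable.biSup C hC fun i _ => hf i
  have hsm : ∀ C D : Set ι, C ⊆ D → ∀ ω, s C ω ≤ s D ω :=
    fun C D h ω => biSup_mono fun i hi => h hi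
  obtain ⟨u, -, hu, huS⟩ := exists_seq_tendsto_sSup (S := J '' {C | C.Countable})
    (Set.Nonempty.image J ⟨∅, Set.countable_empty⟩) (OrderTop.bddAbove _)
  choose C hC hCu using huS
  set D := ⋃ k, C k
  have hDc : D.Countable := Set.countable_iUnion hC
  have hmax : sSup (J '' {C | C.Countable}) ≤ J D := le_of_tendsto' hu fun k => by
    rw [← hCu k]
    exact lintegral_mono fun ω => strictMono_aux.monotone (hsm _ _ (Set.subset_iUnion C k) ω)
  have hJD : J D ≠ ∞ := ne_top_of_le_ne_top (b := 1) ENNReal.one_ne_top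
    ((lintegral_mono fun ω => hφ1 _).trans (by simp))
  have hle : ∀ i, f i ≤ᵐ[Q] s D := by
    intro i
    have hEc : (insert i D).Countable := hDc.insert i
    have hae : (fun ω => φ (s D ω)) =ᵐ[Q] fun ω => φ (s (insert i D) ω) :=
      ae_eq_of_ae_le_of_lintegral_le
        (Eventually.of_forall fun ω => strictMono_aux.monotone (hsm _ _ (Set.subset_insert i D) ω))
        hJD (hφm.comp_aemeasurable (hs _ hEc))
        ((le_sSup (Set.mem_image_of_mem J hEc)).trans hmax)
    filter_upwards [hae] with ω h1
    rw [strictMono_aux.injective h1]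
    exact le_biSup (fun j => f j ω) (Set.mem_insert i D)
  refine ⟨D, hDc, ?_⟩
  have h1 : g ≤ᵐ[Q] (hs D hDc).mk := hg.least _ (hs D hDc).measurable_mk fun i => by
    filter_upwards [hle i, (hs D hDc).ae_eq_mk] with ω e1 e2
    rwa [← e2]
  have h2 : ∀ᵐ ω ∂Q, ∀ i ∈ D, f i ω ≤ g ω := (ae_ball_iff hDc).2 fun i _ => hg.le i
  filter_upwards [h1, h2, (hs D hDc).ae_eq_mk] with ω e1 e2 e3
  rw [← e3] at e1
  exact le_antisymm e1 (iSup₂_le e2)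

theorem IsFamilyEssSup.exists_monotone_seq {ι : Type*} [Nonempty ι] {Q : Measure Ω}
    [IsProbabilityMeasure Q] {f : ι → Ω → EReal} {g : Ω → EReal} (hg : IsFamilyEssSup Q f g)
    (hf : ∀ i, AEMeasurable (f i) Q)
    (hdir : ∀ i j, ∃ l, f i ≤ᵐ[Q] f l ∧ f j ≤ᵐ[Q] f l) :
    ∃ e : ℕ → ι, (∀ᵐ ω ∂Q, Monotone fun k => f (e k) ω) ∧
      g =ᵐ[Q] fun ω => ⨆ k, f (e k) ω := by
  obtain ⟨D, hD, hgD⟩ := hg.exists_countable hf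
  obtain ⟨d, hd⟩ : ∃ d : ℕ → ι, D ⊆ Set.range d := by
    rcases D.eq_empty_or_nonempty with rfl | hne
    · exact ⟨fun _ => Classical.arbitrary ι, Set.empty_subset _⟩
    · obtain ⟨d, hd⟩ := hD.exists_eq_range hne
      exact ⟨d, hd.le⟩
  choose l hl1 hl2 using hdir
  let e : ℕ → ι := fun k => Nat.rec (d 0) (fun k i => l i (d (k + 1))) k
  have hmono : ∀ᵐ ω ∂Q, ∀ k, f (e k) ω ≤ f (e (k + 1)) ω :=
    ae_all_iff.2 fun k => hl1 (e k) (d (k + 1))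
  have hde : ∀ᵐ ω ∂Q, ∀ k, f (d k) ω ≤ f (e k) ω := by
    refine ae_all_iff.2 fun k => ?_
    cases k with
    | zero => exact Eventually.of_forall fun ω => le_rfl
    | succ k => exact hl2 (e k) (d (k + 1))
  refine ⟨e, hmono.mono fun ω h => monotone_nat_of_le_succ h, ?_⟩
  filter_upwards [hgD, hde, ae_all_iff.2 fun k => hg.le (e k)] with ω h1 h2 h3
  refine le_antisymm ?_ (iSup_le h3)
  rw [h1]
  refine iSup₂_le fun i hi => ?_
  obtain ⟨k, rfl⟩ := hd hi
  exact le_iSup_of_le k (h2 k)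

end EssSup

/-! ### Conditional expectations of increasing limits -/

section CondExp

theorem coe_iSup_ofReal_add {a : ℕ → ℝ} {c : ℝ} (ha : ∀ k, -c ≤ a k) :
    ((⨆ k, ENNReal.ofReal (a k + c) : ℝ≥0∞) : EReal) = (⨆ k, (a k : EReal)) + c := by
  have hof : ∀ k, ((ENNReal.ofReal (a k + c) : ℝ≥0∞) : EReal) = (a k : EReal) + c := fun k => by
    rw [EReal.coe_ennreal_ofReal, max_eq_left (by linarith [ha k]), EReal.coe_add]
  have h0 : 0 ≤ (⨆ k, (a k : EReal)) + c := by
    calc (0 : EReal) ≤ (a 0 : EReal) + c := by rw [← hof 0]; exact EReal.coe_ennreal_nonneg _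
      _ ≤ _ := by gcongr; exact le_iSup (fun k => (a k : EReal)) 0
  refine le_antisymm ?_ ?_
  · rw [← EReal.coe_toENNReal h0, EReal.coe_ennreal_le_coe_ennreal_iff]
    refine iSup_le fun k => ?_
    rw [← EReal.toENNReal_coe (x := ENNReal.ofReal (a k + c)), hof]
    refine EReal.toENNReal_le_toENNReal ?_
    gcongr
    exact le_iSup (fun k => (a k : EReal)) k
  · rw [← EReal.le_sub_iff_add_le (Or.inl (EReal.coe_ne_bot c)) (Or.inl (EReal.coe_ne_top c))]
    refine iSup_le fun k => ?_
    rw [EReal.le_sub_iff_add_le (Or.inl (EReal.coe_ne_bot c)) (Or.inl (EReal.coe_ne_top c)),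
      ← hof, EReal.coe_ennreal_le_coe_ennreal_iff]
    exact le_iSup (fun k => ENNReal.ofReal (a k + c)) k

theorem iSup_add_iSup_le {a b : ℕ → ℝ} {z : EReal} (h : ∀ j k, ((a j + b k : ℝ) : EReal) ≤ z) :
    (⨆ j, (a j : EReal)) + ⨆ k, (b k : EReal) ≤ z := by
  refine EReal.add_le_of_forall_lt fun a' ha' b' hb' => ?_
  obtain ⟨j, hj⟩ := lt_iSup_iff.1 ha'
  obtain ⟨k, hk⟩ := lt_iSup_iff.1 hb'
  refine (add_le_add hj.le hk.le).trans ?_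
  rw [← EReal.coe_add]
  exact h j k

variable {Ω : Type*} {m m0 : MeasurableSpace Ω} {Q : Measure Ω}

theorem condLExp_iSup (hm : m ≤ m0) [IsProbabilityMeasure Q] {G : ℕ → Ω → ℝ≥0∞}
    (hG : ∀ k, AEMeasurable (G k) Q) (hmono : ∀ᵐ ω ∂Q, Monotone fun k => G k ω) :
    condLExp m Q (fun ω => ⨆ k, G k ω) =ᵐ[Q] fun ω => ⨆ k, condLExp m Q (G k) ω := by
  symm
  refine ae_eq_condLExp hm Q _ (Measurable.iSup fun k => measurable_condLExp m Q (G k)) ?_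
  intro s hs
  have hmono' : ∀ᵐ ω ∂Q, Monotone fun k => condLExp m Q (G k) ω := by
    have : ∀ᵐ ω ∂Q, ∀ k, condLExp m Q (G k) ω ≤ condLExp m Q (G (k + 1)) ω :=
      ae_all_iff.2 fun k => condLExp_mono (hmono.mono fun ω h => h k.le_succ)
    exact this.mono fun ω h => monotone_nat_of_le_succ h
  rw [lintegral_iSup' (fun k => (measurable_condLExp' m Q (G k)).aemeasurable)
    (ae_restrict_of_ae hmono'), lintegral_iSup' (fun k => (hG k).restrict)
    (ae_restrict_of_ae hmono)]
  simp only [setLIntegral_condLExp hm Q _ hs]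

theorem measurable_condExpEReal (f : Ω → EReal) :
    Measurable (condExpEReal m Q f) := by
  unfold condExpEReal
  have h1 : ∀ g : Ω → ℝ≥0∞, Measurable fun ω => (condLExp m Q g ω : EReal) := fun g =>
    (measurable_condLExp' m Q g).coe_ereal_ennreal
  exact (h1 _).sub (h1 _)

/-- Conditional monotone convergence for the extended real valued conditional expectation of a
supremum of an increasing sequence of integrable functions that is bounded from below. -/
theorem condExpEReal_iSup (hm : m ≤ m0) [IsProbabilityMeasure Q] {f : Ω → EReal}
    {u : ℕ → Ω → ℝ} (hu : ∀ k, Integrable (u k) Q) (hmono : ∀ᵐ ω ∂Q, Monotone fun k => u k ω)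
    (hf : ∀ᵐ ω ∂Q, f ω = ⨆ k, (u k ω : EReal)) {c : ℝ} (hc : ∀ᵐ ω ∂Q, -c ≤ u 0 ω) :
    ∀ᵐ ω ∂Q, condExpEReal m Q f ω = ⨆ k, ((Q[u k | m]) ω : EReal) := by
  have hc0 : ∀ᵐ ω ∂Q, ∀ k, -|c| ≤ u k ω := by
    filter_upwards [hmono, hc] with ω h1 h2 k
    exact (neg_le_neg (le_abs_self c)).trans (h2.trans (h1 (Nat.zero_le k)))
  generalize hd : |c| = d at hc0
  have hd0 : 0 ≤ d := hd ▸ abs_nonneg c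
  have hufc : ∀ k, Integrable (fun ω => u k ω + d) Q := fun k => (hu k).add (integrable_const d)
  have hGm : ∀ k, AEMeasurable (fun ω => ENNReal.ofReal (u k ω + d)) Q := fun k =>
    (hufc k).aestronglyMeasurable.aemeasurable.ennreal_ofReal
  have hfm : AEMeasurable f Q := by
    refine AEMeasurable.congr ?_ (Filter.EventuallyEq.symm hf)
    exact AEMeasurable.iSup fun k => (hu k).aestronglyMeasurable.aemeasurable.coe_real_ereal
  have hbot : ∀ᵐ ω ∂Q, ((-d : ℝ) : EReal) ≤ f ω := by
    filter_upwards [hf, hc0] with ω h1 h2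
    rw [h1]
    exact le_iSup_of_le 0 (EReal.coe_le_coe_iff.2 (h2 0))
  -- `f⁺ + d = (f + d) + f⁻`, both sides being sums of nonnegative functions
  have hsplit : ∀ᵐ ω ∂Q, (f ω).toENNReal + ENNReal.ofReal d =
      (⨆ k, ENNReal.ofReal (u k ω + d)) + (-f ω).toENNReal := by
    filter_upwards [hf, hc0, hbot] with ω h1 h2 h3
    have h4 := coe_iSup_ofReal_add h2
    rw [← h1] at h4
    induction hx : f ω with
    | bot => simp [hx] at h3
    | top =>
      rw [hx, EReal.top_add_coe] at h4
      have : (⨆ k, ENNReal.ofReal (u k ω + d)) = ⊤ := by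
        rwa [EReal.coe_ennreal_eq_top_iff] at h4
      simp [this]
    | coe x =>
      rw [hx, EReal.coe_le_coe_iff] at h3
      rw [hx, ← EReal.coe_add] at h4
      have : (⨆ k, ENNReal.ofReal (u k ω + d)) = ENNReal.ofReal (x + d) := by
        rw [← EReal.toENNReal_coe (x := ⨆ k, ENNReal.ofReal (u k ω + d)), h4,
          EReal.real_coe_toENNReal]
      rw [this, ← EReal.coe_neg, EReal.real_coe_toENNReal, EReal.real_coe_toENNReal]
      rcases le_total 0 x with h0 | h0
      · rw [ENNReal.ofReal_of_nonpos (by linarith : -x ≤ 0), add_zero,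
          ENNReal.ofReal_add h0 hd0]
      · rw [ENNReal.ofReal_of_nonpos h0, zero_add, ← ENNReal.ofReal_add (by linarith) (by linarith)]
        congr 1
        ring
  have e1 : condLExp m Q (fun ω => (f ω).toENNReal + ENNReal.ofReal d) =ᵐ[Q]
      fun ω => condLExp m Q (fun ω => (f ω).toENNReal) ω + ENNReal.ofReal d := by
    have := condLExp_add_left (mΩ := m) (P := Q) (fun _ => ENNReal.ofReal d)
      hfm.ereal_toENNReal
    rw [condLExp_const hm] at this
    exact this
  have e2 : condLExp m Q (fun ω => (⨆ k, ENNReal.ofReal (u k ω + d)) + (-f ω).toENNReal) =ᵐ[Q]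
      fun ω => condLExp m Q (fun ω => ⨆ k, ENNReal.ofReal (u k ω + d)) ω +
        condLExp m Q (fun ω => (-f ω).toENNReal) ω :=
    condLExp_add_left (mΩ := m) (P := Q) (fun ω => (-f ω).toENNReal)
      (AEMeasurable.iSup hGm)
  have e3 := condLExp_iSup hm hGm (by
    filter_upwards [hmono] with ω h i j hij
    exact ENNReal.ofReal_le_ofReal (by linarith [h hij]))
  have e4 : ∀ᵐ ω ∂Q, ∀ k, condLExp m Q (fun ω => ENNReal.ofReal (u k ω + d)) ω =
      ENNReal.ofReal ((Q[u k | m]) ω + d) := by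
    refine ae_all_iff.2 fun k => ?_
    have h1 := condLExp_ofReal m (hufc k) (hc0.mono fun ω h => by
      simp only [Pi.zero_apply]
      linarith [h k])
    have h2 : Q[fun ω => u k ω + d | m] =ᵐ[Q] Q[u k | m] + Q[fun _ => d | m] :=
      condExp_add (hu k) (integrable_const d) m
    rw [condExp_const hm] at h2
    filter_upwards [h1, h2] with ω h3 h4
    rw [h3, h4, Pi.add_apply]
  have e5 : ∀ᵐ ω ∂Q, ∀ k, -d ≤ (Q[u k | m]) ω := by
    refine ae_all_iff.2 fun k => ?_
    have := condExp_mono (m := m) (integrable_const (-d)) (hu k) (hc0.mono fun ω h => h k)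
    rwa [condExp_const hm] at this
  have e6 : ∀ᵐ ω ∂Q, condLExp m Q (fun ω => (-f ω).toENNReal) ω ≤ ENNReal.ofReal d := by
    have := condLExp_mono (mΩ := m) (P := Q) (X := fun ω => (-f ω).toENNReal)
      (Y := fun _ => ENNReal.ofReal d) (by
        filter_upwards [hbot] with ω h
        rw [← EReal.real_coe_toENNReal]
        refine EReal.toENNReal_le_toENNReal ?_
        rw [EReal.neg_le, ← EReal.coe_neg]
        exact h)
    rwa [condLExp_const hm] at this
  filter_upwards [e1, e2, e3, e4, e5, e6, condLExp_congr_ae (mΩ := m) hsplit]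
    with ω h1 h2 h3 h4 h5 h6 h7
  rw [h1, h2, h3] at h7
  simp only [h4] at h7
  have h8 := coe_iSup_ofReal_add h5
  unfold condExpEReal
  generalize condLExp m Q (fun ω => (f ω).toENNReal) ω = A at h7 ⊢
  generalize condLExp m Q (fun ω => (-f ω).toENNReal) ω = B at h6 h7 ⊢
  generalize (⨆ k, ENNReal.ofReal ((Q[u k | m]) ω + d)) = s at h7 h8
  generalize (⨆ k, ((Q[u k | m]) ω : EReal)) = S at h8 ⊢
  have hB : B ≠ ∞ := ne_top_of_le_ne_top ENNReal.ofReal_ne_top h6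
  lift B to ℝ≥0 using hB
  have h9 : (A : EReal) + (d : EReal) = S + d + ((B : ℝ) : EReal) := by
    have := congrArg (fun x : ℝ≥0∞ => (x : EReal)) h7
    simp only [EReal.coe_ennreal_add, EReal.coe_ennreal_ofReal, max_eq_left hd0, h8] at this
    exact this
  change (A : EReal) - ((B : ℝ) : EReal) = S
  generalize (A : EReal) = A' at h9 ⊢
  induction S with
  | bot =>
    induction A' with
    | bot => simp
    | top => simp at h9
    | coe a =>
      rw [← EReal.coe_add, EReal.bot_add, EReal.bot_add] at h9
      exact absurd h9 (EReal.coe_ne_bot _)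
  | top =>
    induction A' with
    | bot => simp at h9
    | top => simp
    | coe a =>
      rw [← EReal.coe_add, EReal.top_add_coe, EReal.top_add_coe] at h9
      exact absurd h9 (EReal.coe_ne_top _)
  | coe x =>
    induction A' with
    | bot =>
      rw [EReal.bot_add, ← EReal.coe_add, ← EReal.coe_add] at h9
      exact absurd h9.symm (EReal.coe_ne_bot _)
    | top =>
      rw [EReal.top_add_coe, ← EReal.coe_add, ← EReal.coe_add] at h9
      exact absurd h9.symm (EReal.coe_ne_top _)
    | coe a =>
      rw [← EReal.coe_add, ← EReal.coe_add, ← EReal.coe_add, EReal.coe_eq_coe_iff] at h9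
      rw [← EReal.coe_sub, EReal.coe_eq_coe_iff]
      linarith

theorem condExp_le_condExpEReal (hm : m ≤ m0) [IsProbabilityMeasure Q] {f : Ω → EReal}
    {u : ℕ → Ω → ℝ} (hu : ∀ k, Integrable (u k) Q) (hmono : ∀ᵐ ω ∂Q, Monotone fun k => u k ω)
    (hf : ∀ᵐ ω ∂Q, f ω = ⨆ k, (u k ω : EReal)) {c : ℝ} (hc : ∀ᵐ ω ∂Q, -c ≤ u 0 ω)
    {v : Ω → ℝ} (hv : Integrable v Q) (hvf : ∀ᵐ ω ∂Q, (v ω : EReal) ≤ f ω) :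
    ∀ᵐ ω ∂Q, ((Q[v | m]) ω : EReal) ≤ condExpEReal m Q f ω := by
  -- `f` is also the limit of the increasing sequence `max v (u k)`
  have h1 := condExpEReal_iSup hm (f := f) (u := fun k ω => max (v ω) (u k ω)) (c := c)
    (fun k => hv.sup (hu k))
    (hmono.mono fun ω h i j hij => max_le_max le_rfl (h hij)) (by
      filter_upwards [hf, hvf] with ω h1 h2
      refine le_antisymm ?_ (iSup_le fun k => ?_)
      · rw [h1]
        exact iSup_mono fun k => EReal.coe_le_coe_iff.2 (le_max_right _ _)
      · rcases max_choice (v ω) (u k ω) with h | h <;> rw [h]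
        · exact h2
        · rw [h1]
          exact le_iSup (fun k => (u k ω : EReal)) k)
    (hc.mono fun ω h => h.trans (le_max_right _ _))
  have h2 : Q[v | m] ≤ᵐ[Q] Q[fun ω => max (v ω) (u 0 ω) | m] :=
    condExp_mono hv (hv.sup (hu 0)) (Eventually.of_forall fun ω => le_max_left _ _)
  filter_upwards [h1, h2] with ω e1 e2
  rw [e1]
  exact le_iSup_of_le 0 (EReal.coe_le_coe_iff.2 e2)

theorem condExp_eq_of_eq_on [IsProbabilityMeasure Q] {A : Set Ω}
    (hA : MeasurableSet[m] A) {f g : Ω → ℝ} (hf : Integrable f Q) (hg : Integrable g Q)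
    (hfg : ∀ᵐ ω ∂Q, ω ∈ A → f ω = g ω) :
    ∀ᵐ ω ∂Q, ω ∈ A → (Q[f | m]) ω = (Q[g | m]) ω := by
  have h1 : A.indicator f =ᵐ[Q] A.indicator g := by
    filter_upwards [hfg] with ω h
    by_cases hω : ω ∈ A
    · simp [hω, h hω]
    · simp [hω]
  filter_upwards [condExp_indicator hf hA, condExp_indicator hg hA,
    condExp_congr_ae (m := m) h1] with ω e1 e2 e3 hω
  rw [e1, e2] at e3
  simpa [hω] using e3

end CondExp

/-! ### The minimal penalty as an increasing limit -/

section Excess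

variable {Ω : Type*} {m n m0 : MeasurableSpace Ω} {P Q : Measure Ω}

/-- The random variable `E_Q(-X | m) - ρ(X)`; the minimal penalty is the essential supremum of
these over all `X`. -/
noncomputable def excess (ρ : LInf n P → LInf m P) (Q : Measure Ω) (X : LInf n P) : Ω → ℝ :=
  fun ω => (Q[fun x => -X.1 x | m]) ω - (ρ X).1 ω

variable {h : m ≤ n} {ρ : LInf n P → LInf m P} [IsProbabilityMeasure Q]

theorem integrable_excess (hm : m ≤ m0) (hQ : Q ≪ P) (X : LInf n P) :
    Integrable (excess ρ Q X) Q :=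
  integrable_condExp.sub (LInf.integrable hm hQ (ρ X))

theorem excess_le_minimalPenalty (X : LInf n P) :
    ∀ᵐ ω ∂Q, (excess ρ Q X ω : EReal) ≤ minimalPenalty ρ Q ω :=
  (isFamilyEssSup_minimalPenalty ρ Q).le X

theorem neg_le_excess (hm : m ≤ m0) (hn : n ≤ m0) (hQ : Q ≪ P) (X : LInf n P) :
    ∀ᵐ ω ∂Q, -(‖X‖ + ‖ρ X‖) ≤ excess ρ Q X ω := by
  have h1 : (fun _ => -‖X‖) ≤ᵐ[Q] fun ω => -X.1 ω := by
    have : ∀ᵐ ω ∂Q, |X.1 ω| ≤ ‖X‖ := hQ.ae_le (LInf.ae_abs_le X)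
    filter_upwards [this] with ω e
    linarith [le_abs_self (X.1 ω)]
  have h2 := condExp_mono (m := m) (integrable_const _) (LInf.integrable hn hQ X).neg h1
  rw [condExp_const hm] at h2
  have h3 : ∀ᵐ ω ∂Q, |(ρ X).1 ω| ≤ ‖ρ X‖ := hQ.ae_le (LInf.ae_abs_le (ρ X))
  filter_upwards [h2, h3] with ω e2 e3
  change _ ≤ (Q[-(X.1 : Ω → ℝ) | m]) ω - (ρ X).1 ω
  linarith [le_abs_self ((ρ X).1 ω)]

/-- The family of excesses is directed upwards: pasting `X` and `Y` along the event where the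
excess of `X` is larger gives the maximum of the two, by locality. -/
theorem exists_excess_ge (hm : m ≤ m0) (hn : n ≤ m0) (hQ : Q ≪ P)
    (hρ : IsConditionalRiskMeasure h ρ) (X Y : LInf n P) :
    ∃ W, (∀ᵐ ω ∂Q, excess ρ Q X ω ≤ excess ρ Q W ω) ∧
      ∀ᵐ ω ∂Q, excess ρ Q Y ω ≤ excess ρ Q W ω := by
  classical
  have hrep : ∀ X : LInf n P, ∃ a : Ω → ℝ, StronglyMeasurable[m] a ∧ excess ρ Q X =ᵐ[Q] a := by
    intro X
    have h1 := LInf.aestronglyMeasurable' hQ (ρ X)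
    refine ⟨fun ω => (Q[fun x => -X.1 x | m]) ω - h1.mk _ ω,
      stronglyMeasurable_condExp.sub h1.stronglyMeasurable_mk, ?_⟩
    filter_upwards [h1.ae_eq_mk] with ω e
    simp only [excess, e]
  obtain ⟨a, ha, hXa⟩ := hrep X
  obtain ⟨b, hb, hYb⟩ := hrep Y
  have hA : MeasurableSet[m] {ω | b ω ≤ a ω} := measurableSet_le hb.measurable ha.measurable
  obtain ⟨W, hW⟩ := LInf.exists_piecewise (P := P) hn (h _ hA) X Y
  have hloc : ∀ (V : LInf n P) (B : Set Ω), MeasurableSet[m] B →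
      (∀ᵐ ω ∂P, ω ∈ B → W.1 ω = V.1 ω) → ∀ᵐ ω ∂Q, ω ∈ B → excess ρ Q W ω = excess ρ Q V ω := by
    intro V B hB hWV
    have h1 := condExp_eq_of_eq_on (Q := Q) hB (LInf.integrable hn hQ W).neg
      (LInf.integrable hn hQ V).neg (hQ.ae_le (hWV.mono fun ω e hω => by
        simp only [Pi.neg_apply, e hω]))
    have h2 : ∀ᵐ ω ∂Q, ω ∈ B → (ρ W).1 ω = (ρ V).1 ω := hQ.ae_le (hρ.eq_of_eq_on hm hB hWV)
    filter_upwards [h1, h2] with ω e1 e2 hω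
    change (Q[-(W.1 : Ω → ℝ) | m]) ω - _ = (Q[-(V.1 : Ω → ℝ) | m]) ω - _
    rw [e1 hω, e2 hω]
  have hWX := hloc X _ hA (hW.mono fun ω e hω => by rw [e, if_pos hω])
  have hWY := hloc Y _ hA.compl (hW.mono fun ω e hω => by rw [e, if_neg hω])
  refine ⟨W, ?_, ?_⟩ <;> filter_upwards [hWX, hWY, hXa, hYb] with ω e1 e2 e3 e4
  · by_cases hω : b ω ≤ a ω
    · exact (e1 hω).ge
    · rw [e2 hω]
      linarith
  · by_cases hω : b ω ≤ a ω
    · rw [e1 hω]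
      linarith
    · exact (e2 hω).ge

theorem exists_seq_minimalPenalty (hm : m ≤ m0) (hn : n ≤ m0) (hQ : Q ≪ P)
    (hρ : IsConditionalRiskMeasure h ρ) :
    ∃ e : ℕ → LInf n P, (∀ᵐ ω ∂Q, Monotone fun k => excess ρ Q (e k) ω) ∧
      ∀ᵐ ω ∂Q, minimalPenalty ρ Q ω = ⨆ k, (excess ρ Q (e k) ω : EReal) := by
  obtain ⟨e, he1, he2⟩ := (isFamilyEssSup_minimalPenalty ρ Q).exists_monotone_seq
    (fun X => (integrable_excess hm hQ X).aestronglyMeasurable.aemeasurable.coe_real_ereal)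
    (fun X Y => by
      obtain ⟨W, h1, h2⟩ := exists_excess_ge hm hn hQ hρ X Y
      exact ⟨W, h1.mono fun ω e => EReal.coe_le_coe_iff.2 e,
        h2.mono fun ω e => EReal.coe_le_coe_iff.2 e⟩)
  exact ⟨e, he1.mono fun ω e i j hij => EReal.coe_le_coe_iff.1 (e hij), he2⟩

theorem excess_add_incl (hm : m ≤ m0) (hn : n ≤ m0) (hQ : Q ≪ P)
    (hρ : IsConditionalRiskMeasure h ρ) (X : LInf n P) (Z : LInf m P) :
    ∀ᵐ ω ∂Q, excess ρ Q (X + LInf.incl h Z) ω = excess ρ Q X ω := by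
  have h1 : (fun ω => -(X + LInf.incl h Z).1 ω) =ᵐ[Q] -(X.1 : Ω → ℝ) - (Z.1 : Ω → ℝ) := by
    have := hQ.ae_le (LInf.coeFn_add X (LInf.incl h Z))
    filter_upwards [this] with ω e
    simp only [Pi.sub_apply, Pi.neg_apply]
    rw [e, neg_add]
    rfl
  have h2 := condExp_of_aestronglyMeasurable' hm (LInf.aestronglyMeasurable' hQ Z)
    (LInf.integrable hm hQ Z)
  have h3 : ∀ᵐ ω ∂Q, (ρ (X + LInf.incl h Z)).1 ω = (ρ X).1 ω - Z.1 ω := by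
    rw [hρ.translation]
    exact hQ.ae_le (LInf.coeFn_sub (ρ X) Z)
  filter_upwards [condExp_congr_ae (m := m) h1, h2, h3,
    condExp_sub (LInf.integrable hn hQ X).neg (LInf.integrable hm hQ Z) m] with ω e1 e2 e3 e4
  change _ = (Q[-(X.1 : Ω → ℝ) | m]) ω - _
  simp only [excess]
  rw [e1, e4, e3, Pi.sub_apply, e2]
  ring

end Excess

/-! ### The cocycle condition -/

section Cocycle

variable {Ω : Type*} {m1 m2 m3 m0 : MeasurableSpace Ω} {P Q : Measure Ω} {h12 : m1 ≤ m2}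
  {h23 : m2 ≤ m3} {ρ12 : LInf m2 P → LInf m1 P} {ρ23 : LInf m3 P → LInf m2 P}
  {ρ13 : LInf m3 P → LInf m1 P}

/-- Under the composition property the excess satisfies the cocycle relation, by the tower
property. -/
theorem excess_eq_of_composition (h12 : m1 ≤ m2) (h20 : m2 ≤ m0)
    [IsProbabilityMeasure Q] (hQ : Q ≪ P) (hc : Composition ρ12 ρ23 ρ13)
    (X : LInf m3 P) : ∀ᵐ ω ∂Q, excess ρ13 Q X ω =
      (Q[excess ρ23 Q X | m1]) ω + excess ρ12 Q (-ρ23 X) ω := by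
  have h1 : (fun ω => -(-ρ23 X).1 ω) =ᵐ[Q] ((ρ23 X).1 : Ω → ℝ) := by
    have := hQ.ae_le (LInf.coeFn_neg (ρ23 X))
    filter_upwards [this] with ω e
    rw [e, neg_neg]
  have h2 := condExp_sub (integrable_condExp (m := m2) (f := fun x => -X.1 x) (μ := Q))
    (LInf.integrable h20 hQ (ρ23 X)) m1
  filter_upwards [condExp_congr_ae (m := m1) h1, h2,
    condExp_condExp_of_le (f := fun x => -X.1 x) (μ := Q) h12 h20] with ω e1 e2 e3
  have e4 : (Q[excess ρ23 Q X | m1]) ω = (Q[fun x => -X.1 x | m1]) ω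
      - (Q[((ρ23 X).1 : Ω → ℝ) | m1]) ω := by
    rw [← e3]
    exact e2
  simp only [excess] at e4 ⊢
  rw [e4, e1, hc X]
  ring

theorem cocycleCondition_of_composition (r12 : IsConditionalRiskMeasure h12 ρ12)
    (r23 : IsConditionalRiskMeasure h23 ρ23) (h30 : m3 ≤ m0)
    (hc : Composition ρ12 ρ23 ρ13) : CocycleCondition ρ12 ρ23 ρ13 := by
  intro Q _ hQ
  have h20 := h23.trans h30
  have h10 := h12.trans h20
  obtain ⟨e, he1, he2⟩ := exists_seq_minimalPenalty (Q := Q) h20 h30 hQ r23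
  obtain ⟨d, -, hd2⟩ := exists_seq_minimalPenalty (Q := Q) h10 h20 hQ r12
  have hlim := condExpEReal_iSup h10 (fun k => integrable_excess h20 hQ (e k)) he1 he2
    (neg_le_excess h20 h30 hQ (e 0))
  have hupper : minimalPenalty ρ13 Q ≤ᵐ[Q]
      fun ω => minimalPenalty ρ12 Q ω + condExpEReal m1 Q (minimalPenalty ρ23 Q) ω := by
    refine (isFamilyEssSup_minimalPenalty ρ13 Q).least _
      ((isFamilyEssSup_minimalPenalty ρ12 Q).measurable.add (measurable_condExpEReal _))
      fun X => ?_
    filter_upwards [excess_eq_of_composition h12 h20 hQ hc X,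
      excess_le_minimalPenalty (ρ := ρ12) (Q := Q) (-ρ23 X),
      condExp_le_condExpEReal h10 (fun k => integrable_excess h20 hQ (e k)) he1 he2
        (neg_le_excess h20 h30 hQ (e 0)) (integrable_excess h20 hQ X)
        (excess_le_minimalPenalty X)] with ω e1 e2 e3
    change (excess ρ13 Q X ω : EReal) ≤ _
    rw [e1, add_comm, EReal.coe_add]
    exact add_le_add e2 e3
  -- every sum of an excess of `ρ12` and a conditional expectation of one of `ρ23` is attained
  have hlower : ∀ᵐ ω ∂Q, ∀ j k, ((excess ρ12 Q (d j) ω + (Q[excess ρ23 Q (e k) | m1]) ω : ℝ) :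
      EReal) ≤ minimalPenalty ρ13 Q ω := by
    refine ae_all_iff.2 fun j => ae_all_iff.2 fun k => ?_
    set X := e k + LInf.incl h23 (ρ23 (e k) + d j) with hX
    have hρX : -ρ23 X = d j := by
      rw [hX, r23.translation]
      abel
    have h1 : Q[excess ρ23 Q X | m1] =ᵐ[Q] Q[excess ρ23 Q (e k) | m1] :=
      condExp_congr_ae (excess_add_incl h20 h30 hQ r23 _ _)
    have h2 := excess_eq_of_composition h12 h20 hQ hc X
    rw [hρX] at h2
    filter_upwards [h1, h2, excess_le_minimalPenalty (ρ := ρ13) (Q := Q) X] with ω e1 e2 e3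
    rw [e2, e1, add_comm] at e3
    exact e3
  filter_upwards [hupper, hlower, hlim, hd2] with ω e1 e2 e3 e4
  refine le_antisymm e1 ?_
  rw [e3, e4]
  exact iSup_add_iSup_le e2

end Cocycle

/-! ### The penalty determines the risk measure -/

section Uniqueness

variable {Ω : Type*} {m n m0 : MeasurableSpace Ω} {P : Measure Ω} {h : m ≤ n}
  {ρ ρ' : LInf n P → LInf m P}

theorem integral_excess (hm : m ≤ m0) {Q : Measure Ω} [IsProbabilityMeasure Q] (hQ : Q ≪ P)
    (X : LInf n P) :
    ∫ ω, excess ρ Q X ω ∂Q = -(∫ ω, X.1 ω ∂Q) - ∫ ω, (ρ X).1 ω ∂Q := by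
  unfold excess
  rw [integral_sub integrable_condExp (LInf.integrable hm hQ _), integral_condExp hm,
    integral_neg]

/-- A bound on the integrals of all excesses of `ρ` is inherited by every integrable random
variable below the minimal penalty. -/
theorem integral_le_of_le_minimalPenalty (hm : m ≤ m0) (hn : n ≤ m0)
    (hρ : IsConditionalRiskMeasure h ρ) {Q : Measure Ω} [IsProbabilityMeasure Q] (hQ : Q ≪ P)
    {C : ℝ} (hC : ∀ Y, ∫ ω, excess ρ Q Y ω ∂Q ≤ C) {v : Ω → ℝ} (hv : Integrable v Q)
    (hle : ∀ᵐ ω ∂Q, (v ω : EReal) ≤ minimalPenalty ρ Q ω) : ∫ ω, v ω ∂Q ≤ C := by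
  obtain ⟨e, he1, he2⟩ := exists_seq_minimalPenalty hm hn hQ hρ
  have hint : ∀ k, Integrable (fun ω => min (v ω) (excess ρ Q (e k) ω)) Q := fun k =>
    hv.inf (integrable_excess hm hQ (e k))
  have hlim : Tendsto (fun k => ∫ ω, min (v ω) (excess ρ Q (e k) ω) ∂Q) atTop
      (𝓝 (∫ ω, v ω ∂Q)) := by
    refine integral_tendsto_of_tendsto_of_monotone hint hv ?_ ?_
    · filter_upwards [he1] with ω h1 i j hij
      exact min_le_min le_rfl (h1 hij)
    · filter_upwards [he1, he2, hle] with ω h1 h2 h3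
      refine tendsto_order.2 ⟨fun c hc => ?_, fun c hc => Eventually.of_forall fun k =>
        (min_le_left _ _).trans_lt hc⟩
      rw [h2] at h3
      obtain ⟨k, hk⟩ := lt_iSup_iff.1 ((EReal.coe_lt_coe_iff.2 hc).trans_le h3)
      filter_upwards [eventually_ge_atTop k] with j hj
      exact lt_min hc ((EReal.coe_lt_coe_iff.1 hk).trans_le (h1 hj))
  refine le_of_tendsto' hlim fun k => (integral_mono (hint k) (integrable_excess hm hQ (e k))
    fun ω => min_le_right _ _).trans (hC (e k))

/-- A risk measure that is continuous from above is dominated by every risk measure whose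
penalties are smaller. -/
theorem le_of_minimalPenalty_le (hm : m ≤ m0) (hn : n ≤ m0) [IsProbabilityMeasure P]
    (hρ : IsConditionalRiskMeasure h ρ) (hc : ContinuousFromAbove ρ)
    (hle : ∀ Q : Measure Ω, IsProbabilityMeasure Q → Q ≪ P →
      minimalPenalty ρ' Q ≤ᵐ[Q] minimalPenalty ρ Q) (X : LInf n P) : ρ X ≤ ρ' X := by
  have key : ∀ S : Measure Ω, IsProbabilityMeasure S → S ≪ P →
      ∫ ω, (ρ X).1 ω ∂S ≤ ∫ ω, (ρ' X).1 ω ∂S := by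
    intro S _ hS
    refine le_of_forall_pos_le_add fun ε hε => ?_
    obtain ⟨Q, _, hQ, hQS, hbound⟩ := exists_measure_minorant hm hn hρ hc hS X hε
    have h1 := integral_le_of_le_minimalPenalty hm hn hρ hQ
      (C := -(∫ ω, X.1 ω ∂Q) - (∫ ω, (ρ X).1 ω ∂S) + ε)
      (fun Y => by
        rw [integral_excess hm hQ, hQS]
        exact hbound Y)
      (integrable_excess (ρ := ρ') hm hQ X) (by
        filter_upwards [hle Q inferInstance hQ, excess_le_minimalPenalty (ρ := ρ') (Q := Q) X]
          with ω e1 e2 using e2.trans e1)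
    rw [integral_excess hm hQ, hQS] at h1
    linarith
  rw [LInf.le_iff]
  have hint : ∀ Z : LInf m P, Integrable Z.1 P :=
    LInf.integrable hm Measure.AbsolutelyContinuous.rfl
  refine ae_le_of_forall_setIntegral_le (hint _) (hint _) fun s hs _ => ?_
  rcases eq_or_ne (P s) 0 with h0 | h0
  · rw [setIntegral_measure_zero _ h0, setIntegral_measure_zero _ h0]
  · have := key (ProbabilityTheory.cond P s) (ProbabilityTheory.cond_isProbabilityMeasure h0)
      ProbabilityTheory.cond_absolutelyContinuous
    simp only [ProbabilityTheory.cond, integral_smul_measure, smul_eq_mul] at this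
    exact le_of_mul_le_mul_left this
      (ENNReal.toReal_pos (ENNReal.inv_ne_zero.2 (measure_ne_top P s)) (ENNReal.inv_ne_top.2 h0))

end Uniqueness

section Equivalence

variable {Ω : Type*} {m1 m2 m3 m0 : MeasurableSpace Ω} {P : Measure Ω} {h12 : m1 ≤ m2}
  {h23 : m2 ≤ m3} {ρ12 : LInf m2 P → LInf m1 P} {ρ23 : LInf m3 P → LInf m2 P}
  {ρ13 : LInf m3 P → LInf m1 P}

theorem composition_of_cocycleCondition [IsProbabilityMeasure P] (h30 : m3 ≤ m0)
    (r12 : IsConditionalRiskMeasure h12 ρ12) (r23 : IsConditionalRiskMeasure h23 ρ23)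
    (r13 : IsConditionalRiskMeasure (h12.trans h23) ρ13) (c12 : ContinuousFromAbove ρ12)
    (c23 : ContinuousFromAbove ρ23) (c13 : ContinuousFromAbove ρ13)
    (hcoc : CocycleCondition ρ12 ρ23 ρ13) : Composition ρ12 ρ23 ρ13 := by
  have h10 := (h12.trans h23).trans h30
  -- the composed risk measure has the same penalties as `ρ13`
  have hcoc' : CocycleCondition ρ12 ρ23 fun X => ρ12 (-ρ23 X) :=
    cocycleCondition_of_composition r12 r23 h30 fun X => rfl
  intro X
  refine le_antisymm
    (le_of_minimalPenalty_le (ρ' := fun X => ρ12 (-ρ23 X)) h10 h30 r13 c13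
      (fun Q hQ hQP => ?_) X)
    (le_of_minimalPenalty_le (ρ := fun X => ρ12 (-ρ23 X)) h10 h30 (r12.comp r23)
      (ContinuousFromAbove.comp r23 c12 c23) (fun Q hQ hQP => ?_) X)
  · filter_upwards [hcoc Q hQ hQP, hcoc' Q hQ hQP] with ω e1 e2
    rw [e1, e2]
  · filter_upwards [hcoc Q hQ hQP, hcoc' Q hQ hQP] with ω e1 e2
    rw [e1, e2]

theorem tfae_composition [IsProbabilityMeasure P] (h30 : m3 ≤ m0)
    (r12 : IsConditionalRiskMeasure h12 ρ12) (r23 : IsConditionalRiskMeasure h23 ρ23)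
    (r13 : IsConditionalRiskMeasure (h12.trans h23) ρ13) (c12 : ContinuousFromAbove ρ12)
    (c23 : ContinuousFromAbove ρ23) (c13 : ContinuousFromAbove ρ13) :
    List.TFAE [Composition ρ12 ρ23 ρ13, AcceptanceDecomposition h23 ρ12 ρ23 ρ13,
      CocycleCondition ρ12 ρ23 ρ13] := by
  tfae_have 1 ↔ 2 := composition_iff_acceptanceDecomposition r12 r23 r13
  tfae_have 1 → 3 := cocycleCondition_of_composition r12 r23 h30
  tfae_have 3 → 1 := composition_of_cocycleCondition h30 r12 r23 r13 c12 c23 c13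
  tfae_finish

end Equivalence

end RiskMeasure
theorem theorem1p6 {Ω : Type*} :
    -- dynamic risk measures and stopping times
    (∀ (m0 : MeasurableSpace Ω) (P : Measure Ω) (_ : IsProbabilityMeasure P)
      (𝓕 : Filtration ℝ≥0 m0) (_ : 𝓕.IsRightContinuous)
      (_ : 𝓕 0 = MeasurableSpace.generateFrom {A | MeasurableSet[m0] A ∧ P A = 0})
      (R : RiskMeasure.DynamicRiskMeasure 𝓕 P) (_ : R.IsContinuousFromAbove)
      (ν σ τ : Ω → WithTop ℝ≥0) (hν : IsStoppingTime 𝓕 ν) (hσ : IsStoppingTime 𝓕 σ)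
      (hτ : IsStoppingTime 𝓕 τ) (hνσ : ν ≤ σ) (hστ : σ ≤ τ),
      List.TFAE
        [RiskMeasure.Composition (R.rho hν hσ hνσ) (R.rho hσ hτ hστ)
            (R.rho hν hτ (hνσ.trans hστ)),
          RiskMeasure.AcceptanceDecomposition (RiskMeasure.stoppingSigma_mono hσ hτ hστ)
            (R.rho hν hσ hνσ) (R.rho hσ hτ hστ) (R.rho hν hτ (hνσ.trans hστ)),
          RiskMeasure.CocycleCondition (R.rho hν hσ hνσ) (R.rho hσ hτ hστ)
            (R.rho hν hτ (hνσ.trans hστ))]) ∧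
    -- three nested σ-algebras and normalized conditional risk measures
    (∀ (m1 m2 m3 : MeasurableSpace Ω) (h12 : m1 ≤ m2) (h23 : m2 ≤ m3)
      (P : Measure[m3] Ω) (_ : IsProbabilityMeasure P)
      (ρ12 : RiskMeasure.LInf m2 P → RiskMeasure.LInf m1 P)
      (ρ23 : RiskMeasure.LInf m3 P → RiskMeasure.LInf m2 P)
      (ρ13 : RiskMeasure.LInf m3 P → RiskMeasure.LInf m1 P)
      (_ : RiskMeasure.IsConditionalRiskMeasure h12 ρ12)
      (_ : RiskMeasure.IsConditionalRiskMeasure h23 ρ23)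
      (_ : RiskMeasure.IsConditionalRiskMeasure (h12.trans h23) ρ13)
      (_ : ρ12 0 = 0) (_ : ρ23 0 = 0) (_ : ρ13 0 = 0)
      (_ : RiskMeasure.ContinuousFromAbove ρ12) (_ : RiskMeasure.ContinuousFromAbove ρ23)
      (_ : RiskMeasure.ContinuousFromAbove ρ13),
      List.TFAE
        [RiskMeasure.Composition ρ12 ρ23 ρ13,
          RiskMeasure.AcceptanceDecomposition h23 ρ12 ρ23 ρ13,
          RiskMeasure.CocycleCondition ρ12 ρ23 ρ13]) := by
  refine ⟨fun m0 P _ 𝓕 _ _ R hR ν σ τ hν hσ hτ hνσ hστ => ?_,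
    fun m1 m2 m3 h12 h23 P _ ρ12 ρ23 ρ13 r12 r23 r13 _ _ _ c12 c23 c13 =>
      RiskMeasure.tfae_composition le_rfl r12 r23 r13 c12 c23 c13⟩
  exact RiskMeasure.tfae_composition (fun A hA => hA.1) (R.isRiskMeasure hν hσ hνσ)
    (R.isRiskMeasure hσ hτ hστ) (R.isRiskMeasure hν hτ (hνσ.trans hστ)) (hR hν hσ hνσ)
    (hR hσ hτ hστ) (hR hν hτ (hνσ.trans hστ))
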